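/- Let $n\ge 4$ be an even integer, let $u:\mathbb{R}^n\to\mathbb{R}$ be smooth, and let $g=e^{2u}|dx|^2$, with scalar curvature $R_g$ and Q-curvature $Q$ given by $(-\Delta)^{n/2}u=Qe^{nu}$. Suppose that $g$ has finite total Q-curvature, i.e. $Qe^{nu}\in L^1(\mathbb{R}^n)$, and that $g$ is normal, i.e. for some constant $C$ and all $x\in\mathbb{R}^n$ $$u(x)=\frac{2}{(n-1)!\,|\mathbb{S}^n|}\int_{\mathbb{R}^n}\log\frac{|y|}{|x-y|}\,Q(y)e^{nu(y)}\,dy+C.$$ Let the conformal mass of $g$ be $$m_c(g):=\frac{1}{(n-1)(n-2)|\mathbb{S}^{n-1}|}\,\inf_{x\in\mathbb{R}^n}\,\liminf_{r\to\infty}\, r^{3-n}\int_{\partial B_r(x)}R_g e^{2u}\,d\sigma\in[-\infty,+\infty],$$ where $d\sigma$ is the Euclidean area element and $|\mathbb{S}^k|$ is the area of the unit sphere $\mathbb{S}^k\subset\mathbb{R}^{k+1}$. Then $$m_c(g)=-\frac{4}{n!\,|\mathbb{S}^n|}\int_{\mathbb{R}^n}x\cdot\nabla Q\; e^{nu}\,dx$$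 whenever the integral on the right exists, either as a Lebesgue integral ($x\cdot\nabla Q\,e^{nu}\in L^1(\mathbb{R}^n)$) or as an improper integral $\lim_{r\to\infty}\int_{B_r(0)}x\cdot\nabla Q\,e^{nu}\,dx\in\mathbb{R}$. Without any assumption on the existence of this integral, $m_c(g)$ is finite and there is a sequence $r_k\to\infty$ with $$m_c(g)=-\frac{4}{n!\,|\mathbb{S}^n|}\lim_{k\to\infty}\int_{B_{r_k}(0)}x\cdot\nabla Q\;e^{nu}\,dx .$$ -/

import Mathlib

open MeasureTheory Filter Topology Metric
open scoped ContDiff Gradient Nat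

/-- `ℝⁿ` with its Euclidean norm. -/
abbrev RSpace (n : ℕ) : Type := EuclideanSpace ℝ (Fin n)

noncomputable section

/-! ### Spheres -/

/-- `|𝕊ᵏ|`, the area of the unit sphere of `ℝᵏ⁺¹`. -/
def sphereArea (k : ℕ) : ℝ :=
  ((volume : Measure (RSpace (k + 1))).toSphere).real Set.univ

/-- `∫_{∂B_r(x)} f dσ`, where `dσ` is the Euclidean area element of the sphere `∂B_r(x)`, `r > 0`. -/
def sphereIntegral {n : ℕ} (f : RSpace n → ℝ) (x : RSpace n) (r : ℝ) : ℝ :=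
  r ^ (n - 1) *
    ∫ w : sphere (0 : RSpace n) 1, f (x + r • (w : RSpace n)) ∂(volume : Measure (RSpace n)).toSphere

/-! ### Curvature of a Riemannian metric on `ℝⁿ`, in the standard coordinates -/

/-- The partial derivative `∂ᵢ f`. -/
def partialDeriv {n : ℕ} (i : Fin n) (f : RSpace n → ℝ) (x : RSpace n) : ℝ :=
  fderiv ℝ f x (EuclideanSpace.single i 1)

/-- Christoffel symbols `Γᵏᵢⱼ = ½ ∑ₗ gᵏˡ (∂ᵢ gⱼₗ + ∂ⱼ gᵢₗ - ∂ₗ gᵢⱼ)`. -/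
def christoffel {n : ℕ} (g : RSpace n → Matrix (Fin n) (Fin n) ℝ) (k i j : Fin n)
    (x : RSpace n) : ℝ :=
  (1 / 2) * ∑ l, (g x)⁻¹ k l *
    (partialDeriv i (fun y => g y j l) x + partialDeriv j (fun y => g y i l) x
      - partialDeriv l (fun y => g y i j) x)

/-- Ricci curvature
`Rᵢⱼ = ∑ₖ (∂ₖ Γᵏᵢⱼ - ∂ⱼ Γᵏᵢₖ) + ∑ₖₗ (Γᵏₖₗ Γˡᵢⱼ - Γᵏⱼₗ Γˡᵢₖ)`. -/
def ricciCurvature {n : ℕ} (g : RSpace n → Matrix (Fin n) (Fin n) ℝ) (i j : Fin n)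
    (x : RSpace n) : ℝ :=
  ∑ k, (partialDeriv k (christoffel g k i j) x - partialDeriv j (christoffel g k i k) x)
    + ∑ k, ∑ l, (christoffel g k k l x * christoffel g l i j x
        - christoffel g k j l x * christoffel g l i k x)

/-- Scalar curvature `R_g = ∑ᵢⱼ gⁱʲ Rᵢⱼ`. -/
def scalarCurvature {n : ℕ} (g : RSpace n → Matrix (Fin n) (Fin n) ℝ) (x : RSpace n) : ℝ :=
  ∑ i, ∑ j, (g x)⁻¹ i j * ricciCurvature g i j x

/-! ### Conformal metrics on `ℝⁿ` -/

/-- The conformal metric `g = e^{2u} |dx|²`. -/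
def conformalMetric {n : ℕ} (u : RSpace n → ℝ) (x : RSpace n) : Matrix (Fin n) (Fin n) ℝ :=
  Real.exp (2 * u x) • (1 : Matrix (Fin n) (Fin n) ℝ)

/-- The Q-curvature of `e^{2u} |dx|²` for even `n`: the function `Q` with
`(-Δ)^{n/2} u = Q e^{nu}`. -/
def qCurvature {n : ℕ} (u : RSpace n → ℝ) (x : RSpace n) : ℝ :=
  ((fun f : RSpace n → ℝ => -Laplacian.laplacian f)^[n / 2] u) x * Real.exp (-(n * u x))

/-- Finite total Q-curvature: `Q e^{nu} ∈ L¹(ℝⁿ)`. -/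
def HasFiniteTotalQCurvature {n : ℕ} (u : RSpace n → ℝ) : Prop :=
  Integrable (fun x : RSpace n => qCurvature u x * Real.exp (n * u x))

/-- The metric `e^{2u} |dx|²` of finite total Q-curvature is normal:
`u(x) = 2 / ((n-1)! |𝕊ⁿ|) ∫ log (|y| / |x - y|) Q(y) e^{n u(y)} dy + C`. -/
def IsNormalMetric {n : ℕ} (u : RSpace n → ℝ) : Prop :=
  HasFiniteTotalQCurvature u ∧
  ∃ C : ℝ, ∀ x : RSpace n,
    u x = 2 / ((n - 1)! * sphereArea n) *
      (∫ y : RSpace n, Real.log (‖y‖ / ‖x - y‖) * (qCurvature u y * Real.exp (n * u y))) + C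

/-- The conformal mass `m_c(g)` of `g = e^{2u} |dx|²`, an extended real number:
`1 / ((n-1)(n-2)|𝕊ⁿ⁻¹|) inf_x liminf_{r → ∞} r^{3-n} ∫_{∂B_r(x)} R_g e^{2u} dσ`. -/
def conformalMass {n : ℕ} (u : RSpace n → ℝ) : EReal :=
  ((1 / (((n : ℝ) - 1) * ((n : ℝ) - 2) * sphereArea (n - 1)) : ℝ) : EReal) *
    ⨅ x : RSpace n, liminf (fun r : ℝ =>
      ((r ^ (3 - (n : ℤ)) * sphereIntegral
        (fun y => scalarCurvature (conformalMetric u) y * Real.exp (2 * u y)) x r : ℝ) : EReal)) atTop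

/-- The function `x ↦ (x · ∇Q) e^{nu}`. -/
def pohozaevDensity {n : ℕ} (u : RSpace n → ℝ) (x : RSpace n) : ℝ :=
  inner ℝ x (∇ (qCurvature u) x) * Real.exp (n * u x)

end

/-! Put `f = Q e^{nu}`, `c = 2 / ((n-1)! |𝕊ⁿ|)` and `α = c ∫ f`. Both sides of the identity are
computed separately and equal `α (2 - α)`.

Mass side: the conformal change formula reads `R_g e^{2u} = -2(n-1) Δu - (n-1)(n-2) |∇u|²`.
Differentiating the logarithmic potential twice gives `∇u = -c ∫ (x-y)/|x-y|² f(y) dy` and `Δu =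
-c(n-2) ∫ |x-y|⁻² f(y) dy`. On large spheres `r ∇u → -α w` and `r² Δu → -(n-2) α` in the mean, so
the rescaled sphere integral has a genuine limit, the same for every centre (`conformalMass_eq`).

Pohozaev side: `x·∇Q e^{nu} = x·∇f - n f x·∇u`. On `B_r` the divergence theorem turns the first term
into a boundary flux minus `n ∫_{B_r} f`. In the second, the kernel `x·(x-y)/|x-y|²` symmetrises to
`1/2`, leaving `(nc/2)(∫_{B_r} f)²` and an interaction of `B_r` with its complement. The flux and
the interaction are both integrable against `dr/r`, which has infinite mass at infinity, so they are
small together along some `r_k → ∞` (`exists_seq_tendsto_pohozaev`). If the integral over balls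
converges, its limit is the one along `r_k`. -/

/-! ### Scalar curvature of a conformally flat metric -/

section Curvature

variable {n : ℕ} {u : RSpace n → ℝ}

theorem ContDiff.partialDeriv {f : RSpace n → ℝ} (hf : ContDiff ℝ ∞ f) (i : Fin n) :
    ContDiff ℝ ∞ (partialDeriv i f) :=
  (hf.fderiv_right (m := ∞) (by simp)).clm_apply contDiff_const

theorem ContDiff.differentiable_infty {f : RSpace n → ℝ} (hf : ContDiff ℝ ∞ f) :
    Differentiable ℝ f :=
  hf.differentiable (by simp)

theorem conformalMetric_apply (x : RSpace n) (i j : Fin n) :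
    conformalMetric u x i j = Real.exp (2 * u x) * if i = j then 1 else 0 := by
  simp [conformalMetric, Matrix.one_apply]

theorem conformalMetric_inv (x : RSpace n) (i j : Fin n) :
    (conformalMetric u x)⁻¹ i j = Real.exp (-(2 * u x)) * if i = j then 1 else 0 := by
  have h : (conformalMetric u x)⁻¹ = Real.exp (-(2 * u x)) • (1 : Matrix (Fin n) (Fin n) ℝ) := by
    apply Matrix.inv_eq_left_inv
    rw [conformalMetric, smul_mul_smul_comm, ← Real.exp_add]
    simp
  simp [h, Matrix.one_apply]

theorem partialDeriv_conformalMetric (hu : Differentiable ℝ u) (l i j : Fin n) (x : RSpace n) :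
    partialDeriv l (fun y => conformalMetric u y i j) x
      = 2 * partialDeriv l u x * Real.exp (2 * u x) * if i = j then 1 else 0 := by
  simp only [conformalMetric_apply, partialDeriv]
  have h : HasFDerivAt (fun y => Real.exp (2 * u y) * if i = j then (1 : ℝ) else 0) _ x :=
    (((hu x).hasFDerivAt.const_mul 2).exp).mul_const _
  rw [h.fderiv]
  simp only [smul_apply, smul_eq_mul]
  ring

theorem christoffel_conformalMetric (hu : Differentiable ℝ u) (k i j : Fin n) :
    christoffel (conformalMetric u) k i j = fun x =>
      (if j = k then 1 else 0) * partialDeriv i u x + (if i = k then 1 else 0) * partialDeriv j u x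
        - (if i = j then 1 else 0) * partialDeriv k u x := by
  funext x
  have h : Real.exp (-(2 * u x)) * Real.exp (2 * u x) = 1 := by
    rw [← Real.exp_add]; simp
  simp only [christoffel, conformalMetric_inv, partialDeriv_conformalMetric hu]
  simp only [mul_ite, mul_one, mul_zero, ite_mul, zero_mul, Finset.sum_ite_eq, Finset.mem_univ,
    if_true]
  have e : ∀ a : ℝ, Real.exp (-(2 * u x)) * (2 * a * Real.exp (2 * u x)) = 2 * a := by
    intro a; linear_combination 2 * a * h
  split_ifs <;> simp only [mul_sub, mul_add, e, mul_zero] <;> ring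

theorem partialDeriv_christoffel_conformalMetric (hu : ContDiff ℝ ∞ u) (l k i j : Fin n)
    (x : RSpace n) :
    partialDeriv l (christoffel (conformalMetric u) k i j) x =
      (if j = k then 1 else 0) * partialDeriv l (partialDeriv i u) x
        + (if i = k then 1 else 0) * partialDeriv l (partialDeriv j u) x
        - (if i = j then 1 else 0) * partialDeriv l (partialDeriv k u) x := by
  rw [christoffel_conformalMetric hu.differentiable_infty]
  have d : ∀ i, HasFDerivAt (partialDeriv i u) (fderiv ℝ (partialDeriv i u) x) x := fun i =>
    ((hu.partialDeriv i).differentiable_infty x).hasFDerivAt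
  have h : HasFDerivAt (fun x => (if j = k then 1 else 0) * partialDeriv i u x
      + (if i = k then 1 else 0) * partialDeriv j u x
      - (if i = j then 1 else 0) * partialDeriv k u x) _ x :=
    (((d i).const_mul _).add ((d j).const_mul _)).sub ((d k).const_mul _)
  rw [partialDeriv, h.fderiv]
  rfl

/-- The inverse metric is a multiple of the identity, so the scalar curvature only sees diagonal
entries. -/
theorem ricciCurvature_conformalMetric_diag (hu : ContDiff ℝ ∞ u) (i : Fin n) (x : RSpace n) :
    ricciCurvature (conformalMetric u) i i x =
      (2 - n) * partialDeriv i (partialDeriv i u) x - ∑ k, partialDeriv k (partialDeriv k u) x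
        + (n - 2) * partialDeriv i u x ^ 2 - (n - 2) * ∑ k, partialDeriv k u x ^ 2 := by
  simp only [ricciCurvature, partialDeriv_christoffel_conformalMetric hu]
  simp only [christoffel_conformalMetric hu.differentiable_infty]
  -- With the gradient and Hessian at `x` as free variables, what remains is an identity between
  -- Kronecker-delta sums. Symmetry of the Hessian is not needed: the deltas leave only diagonal
  -- entries.
  generalize hU : (fun i => partialDeriv i u x) = U
  generalize hH : (fun i j => partialDeriv i (partialDeriv j u) x) = H
  have hU' : ∀ i, partialDeriv i u x = U i := fun i => congrFun hU i
  have hH' : ∀ i j, partialDeriv i (partialDeriv j u) x = H i j := fun i j =>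
    congrFun (congrFun hH i) j
  simp only [hU', hH']
  have h1 : ∑ k, ((if i = k then (1 : ℝ) else 0) * H k i + (if i = k then 1 else 0) * H k i
      - (if i = i then 1 else 0) * H k k - ((if k = k then 1 else 0) * H i i
        + (if i = k then 1 else 0) * H i k - (if i = k then 1 else 0) * H i k))
      = (2 - n) * H i i - ∑ k, H k k := by
    simp [Finset.sum_sub_distrib, Finset.sum_add_distrib]
    ring
  have h2 : ∀ k l, ((if l = k then (1 : ℝ) else 0) * U k + (if k = k then 1 else 0) * U l
        - (if k = l then 1 else 0) * U k) * ((if i = l then 1 else 0) * U i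
        + (if i = l then 1 else 0) * U i - (if i = i then 1 else 0) * U l)
      - ((if l = k then 1 else 0) * U i + (if i = k then 1 else 0) * U l
        - (if i = l then 1 else 0) * U k) * ((if k = l then 1 else 0) * U i
        + (if i = l then 1 else 0) * U k - (if i = k then 1 else 0) * U l)
      = (2 * (if i = l then U l * U i else 0) - U l ^ 2) - ((if l = k then U i ^ 2 else 0)
        - ((if i = k then U l ^ 2 else 0) + (if i = l then U k ^ 2 else 0)
          - 2 * (if i = k then (if i = l then U k * U l else 0) else 0))) := by
    intro k l
    simp only [eq_comm (a := l) (b := k)]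
    split_ifs <;> (try subst_vars) <;> (try contradiction) <;> ring
  simp only [if_true] at h1 h2 ⊢
  rw [h1, Finset.sum_congr rfl fun k _ => Finset.sum_congr rfl fun l _ => h2 k l]
  simp [Finset.sum_sub_distrib, Finset.sum_add_distrib]
  ring

/-- `R_g e^{2u} = -2(n-1) Δu - (n-1)(n-2) |∇u|²` for `g = e^{2u} |dx|²`. -/
theorem scalarCurvature_conformalMetric (hu : ContDiff ℝ ∞ u) (x : RSpace n) :
    scalarCurvature (conformalMetric u) x * Real.exp (2 * u x) =
      -(2 * (n - 1)) * ∑ k, partialDeriv k (partialDeriv k u) x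
        - (n - 1) * (n - 2) * ∑ k, partialDeriv k u x ^ 2 := by
  have h : Real.exp (-(2 * u x)) * Real.exp (2 * u x) = 1 := by
    rw [← Real.exp_add]; simp
  have e : scalarCurvature (conformalMetric u) x =
      Real.exp (-(2 * u x)) * ∑ i, ricciCurvature (conformalMetric u) i i x := by
    simp [scalarCurvature, conformalMetric_inv, Finset.mul_sum]
  rw [e]
  simp only [ricciCurvature_conformalMetric_diag hu]
  rw [mul_right_comm, h]
  simp only [Finset.sum_sub_distrib, Finset.sum_add_distrib, ← Finset.mul_sum, Finset.sum_const,
    Finset.card_univ, Fintype.card_fin, nsmul_eq_mul]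
  ring

end Curvature

/-! ### Integrability of the kernels `|x - y|⁻ᵖ`, `p < n` -/

section Kernel

variable {n : ℕ}

theorem RSpace.nontrivial (hn : 0 < n) : Nontrivial (RSpace n) :=
  Module.nontrivial_of_finrank_pos (R := ℝ) (by simpa using hn)

theorem integrableOn_ball_inv_norm_pow {p : ℕ} (hp : p < n) (R : ℝ) :
    IntegrableOn (fun z : RSpace n => ‖z‖⁻¹ ^ p) (ball 0 R) := by
  have := RSpace.nontrivial (n := n) (by omega)
  refine (integrableOn_fun_norm_addHaar volume (f := fun r : ℝ => r⁻¹ ^ p) (r := R)).2 ?_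
  have h : IntegrableOn (fun y : ℝ => y ^ (n - 1 - p)) (Set.Ioo 0 R) :=
    ((continuous_pow _).continuousOn.integrableOn_Icc).mono_set Set.Ioo_subset_Icc_self
  refine h.congr_fun (fun y hy => ?_) measurableSet_Ioo
  have hy0 : y ≠ 0 := hy.1.ne'
  simp only [finrank_euclideanSpace, Fintype.card_fin, smul_eq_mul]
  rw [inv_pow, ← div_eq_mul_inv, eq_div_iff (pow_ne_zero _ hy0), ← pow_add]
  congr 1
  omega

theorem integrableOn_ball_inv_norm_sub_pow {p : ℕ} (hp : p < n) (x : RSpace n) (R : ℝ) :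
    IntegrableOn (fun y : RSpace n => ‖x - y‖⁻¹ ^ p) (ball x R) := by
  have h := (Measure.measurePreserving_sub_left volume x).integrableOn_comp_preimage
    (MeasurableEquiv.subLeft x).measurableEmbedding (f := fun z : RSpace n => ‖z‖⁻¹ ^ p) (s := ball 0 R)
  have e : (fun y => x - y) ⁻¹' ball (0 : RSpace n) R = ball x R := by
    ext y; simp [mem_ball, dist_eq_norm, norm_sub_rev]
  rw [e] at h
  exact h.2 (integrableOn_ball_inv_norm_pow hp R)

theorem setIntegral_ball_inv_norm_sub_pow {p : ℕ} (x : RSpace n) (R : ℝ) :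
    ∫ y in ball x R, ‖x - y‖⁻¹ ^ p = ∫ z in ball (0 : RSpace n) R, ‖z‖⁻¹ ^ p := by
  have h := (Measure.measurePreserving_sub_left volume x).setIntegral_preimage_emb
    (MeasurableEquiv.subLeft x).measurableEmbedding (fun z : RSpace n => ‖z‖⁻¹ ^ p) (ball 0 R)
  have e : (fun y => x - y) ⁻¹' ball (0 : RSpace n) R = ball x R := by
    ext y; simp [mem_ball, dist_eq_norm, norm_sub_rev]
  rwa [e] at h

/-- Absolute continuity of the integral: the volume of `ball 0 r` tends to `0`. -/
theorem tendsto_setIntegral_ball_inv_norm_pow {p : ℕ} (hp : p < n) :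
    Tendsto (fun r : ℝ => ∫ z in ball (0 : RSpace n) r, ‖z‖⁻¹ ^ p) (𝓝 0) (𝓝 0) := by
  have := RSpace.nontrivial (n := n) (by omega)
  have h1 : Tendsto (fun r : ℝ => volume.restrict (ball (0 : RSpace n) 1) (ball 0 r))
      (𝓝 0) (𝓝 0) := by
    have h2 : Tendsto (fun r : ℝ => ENNReal.ofReal (r ^ n) * volume (ball (0 : RSpace n) 1))
        (𝓝 0) (𝓝 0) := by
      have : Tendsto (fun r : ℝ => ENNReal.ofReal (r ^ n)) (𝓝 0) (𝓝 0) := by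
        have := (ENNReal.continuous_ofReal.comp (continuous_pow (M := ℝ) n)).tendsto 0
        simpa [Function.comp_def, zero_pow (show n ≠ 0 by omega)] using this
      simpa using ENNReal.Tendsto.mul_const this (Or.inr measure_ball_lt_top.ne)
    refine tendsto_of_tendsto_of_tendsto_of_le_of_le tendsto_const_nhds h2 (fun _ => zero_le) ?_
    intro r
    refine (Measure.restrict_apply_le _ _).trans ?_
    rcases le_or_gt 0 r with hr | hr
    · simp [Measure.addHaar_ball _ _ hr]
    · simp [ball_eq_empty.2 hr.le]
  have h3 := (integrableOn_ball_inv_norm_pow hp 1).integrable.tendsto_setIntegral_nhds_zero h1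
  refine h3.congr' ?_
  filter_upwards [gt_mem_nhds (zero_lt_one (α := ℝ))] with r hr
  rw [Measure.restrict_restrict measurableSet_ball,
    Set.inter_eq_left.2 (ball_subset_ball hr.le)]

theorem exists_bound_on_ball {f : RSpace n → ℝ} (hf : Continuous f) (x : RSpace n) (R : ℝ) :
    ∃ M, 0 ≤ M ∧ ∀ y ∈ ball x R, |f y| ≤ M := by
  obtain ⟨M, hM⟩ := (isCompact_closedBall x R).exists_bound_of_continuousOn hf.continuousOn
  exact ⟨max M 0, le_max_right _ _, fun y hy =>
    (hM y (ball_subset_closedBall hy)).trans (le_max_left _ _)⟩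

/-- Near `x` the density is bounded and the kernel integrable; at distance at least `1` the kernel
is at most `1` and the density integrable. -/
theorem integrable_inv_norm_sub_pow_mul {p : ℕ} (hp : p < n) {f : RSpace n → ℝ}
    (hf : Continuous f) (hfi : Integrable f) (x : RSpace n) :
    Integrable (fun y => ‖x - y‖⁻¹ ^ p * f y) := by
  have hm : Measurable (fun y => ‖x - y‖⁻¹ ^ p * f y) := by fun_prop
  obtain ⟨M, hM0, hM⟩ := exists_bound_on_ball hf x 1
  rw [← integrableOn_univ, ← Set.union_compl_self (ball x 1), integrableOn_union]
  constructor
  · refine ((integrableOn_ball_inv_norm_sub_pow hp x 1).mul_const M).mono'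
      hm.aestronglyMeasurable ?_
    filter_upwards [ae_restrict_mem measurableSet_ball] with y hy
    rw [norm_mul, Real.norm_of_nonneg (by positivity)]
    exact mul_le_mul_of_nonneg_left (hM y hy) (by positivity)
  · refine hfi.norm.integrableOn.mono' hm.aestronglyMeasurable ?_
    filter_upwards [ae_restrict_mem measurableSet_ball.compl] with y hy
    rw [norm_mul, Real.norm_of_nonneg (by positivity)]
    refine mul_le_of_le_one_left (norm_nonneg _) (pow_le_one₀ (by positivity) ?_)
    apply inv_le_one_of_one_le₀
    simpa [dist_eq_norm, norm_sub_rev] using hy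

end Kernel

/-! ### First and second derivatives of the logarithmic potential -/

section Potential

variable {n : ℕ}

/-- Only differences of the kernel are integrated: for `k = log |·|` the function `k (x - y) * f y`
alone need not be integrable at infinity. -/
theorem integrable_slope_mul {p : ℕ} (hp : p < n) {k : RSpace n → ℝ} {C : ℝ}
    (hkm : Measurable k)
    (hk : ∀ a b, a ≠ 0 → b ≠ 0 → |k a - k b| ≤ C * ‖a - b‖ * (‖a‖⁻¹ ^ p + ‖b‖⁻¹ ^ p))
    {f : RSpace n → ℝ} (hf : Continuous f) (hfi : Integrable f) (x x' : RSpace n) :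
    Integrable (fun y => (k (x' - y) - k (x - y)) * f y) := by
  have := RSpace.nontrivial (n := n) (by omega)
  have hb : Integrable (fun y => C * ‖x' - x‖ * (‖x' - y‖⁻¹ ^ p * |f y| + ‖x - y‖⁻¹ ^ p * |f y|)) :=
    ((integrable_inv_norm_sub_pow_mul hp hf.abs hfi.abs x').add
      (integrable_inv_norm_sub_pow_mul hp hf.abs hfi.abs x)).const_mul _
  refine hb.mono' ?_ ?_
  · exact (((hkm.comp (by fun_prop)).sub (hkm.comp (by fun_prop))).mul
      hf.measurable).aestronglyMeasurable
  · filter_upwards [Measure.ae_ne volume x, Measure.ae_ne volume x'] with y hy hy'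
    have := hk (x' - y) (x - y) (sub_ne_zero.2 hy'.symm) (sub_ne_zero.2 hy.symm)
    rw [sub_sub_sub_cancel_right] at this
    rw [norm_mul, Real.norm_eq_abs, Real.norm_eq_abs]
    calc _ ≤ _ := mul_le_mul_of_nonneg_right this (abs_nonneg _)
      _ = _ := by ring

/-- Differentiation of a potential whose kernel has a gradient of order `‖z‖⁻ᵖ`, `p < n`. -/
theorem tendsto_integral_slope_mul {p : ℕ} (hp : p < n) {k K : RSpace n → ℝ} {C : ℝ} (hC : 0 ≤ C)
    {v : RSpace n} (hkm : Measurable k)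
    (hk : ∀ a b, a ≠ 0 → b ≠ 0 → |k a - k b| ≤ C * ‖a - b‖ * (‖a‖⁻¹ ^ p + ‖b‖⁻¹ ^ p))
    (hK : ∀ z, z ≠ 0 → HasLineDerivAt ℝ k (K z) z v)
    {f : RSpace n → ℝ} (hf : Continuous f) (hfi : Integrable f) (x : RSpace n) :
    Tendsto (fun t : ℝ => t⁻¹ * ∫ y, (k (x + t • v - y) - k (x - y)) * f y) (𝓝[≠] 0)
      (𝓝 (∫ y, K (x - y) * f y)) := by
  have := RSpace.nontrivial (n := n) (by omega)
  obtain ⟨M, hM0, hM⟩ := exists_bound_on_ball hf x 1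
  set D : ℝ → RSpace n → ℝ := fun t y => t⁻¹ * ((k (x + t • v - y) - k (x - y)) * f y) with hD
  -- This shrinking ball contains both singularities `x` and `x + t • v`. Outside it the difference
  -- quotient is dominated by a multiple of `‖x - y‖⁻¹ ^ p * |f y|`; inside, its integral tends to
  -- zero.
  set A : ℝ → Set (RSpace n) := fun t => ball x (2 * ‖t • v‖) with hA
  have hDi : ∀ t, Integrable (D t) := fun t =>
    (integrable_slope_mul hp hkm hk hf hfi x (x + t • v)).const_mul _
  have hDb : ∀ t : ℝ, t ≠ 0 → ∀ y, y ≠ x → y ≠ x + t • v →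
      |D t y| ≤ C * ‖v‖ * (‖x + t • v - y‖⁻¹ ^ p + ‖x - y‖⁻¹ ^ p) * |f y| := by
    intro t ht y hy hy'
    have := hk (x + t • v - y) (x - y) (sub_ne_zero.2 hy'.symm) (sub_ne_zero.2 hy.symm)
    rw [sub_sub_sub_cancel_right, add_sub_cancel_left, norm_smul, Real.norm_eq_abs] at this
    have ht' : |t|⁻¹ * |t| = 1 := inv_mul_cancel₀ (abs_ne_zero.2 ht)
    rw [hD]
    simp only [abs_mul, abs_inv]
    calc |t|⁻¹ * (|k (x + t • v - y) - k (x - y)| * |f y|)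
        ≤ |t|⁻¹ * ((C * (|t| * ‖v‖) * (‖x + t • v - y‖⁻¹ ^ p + ‖x - y‖⁻¹ ^ p)) * |f y|) := by
          gcongr
      _ = (|t|⁻¹ * |t|) * (C * ‖v‖ * (‖x + t • v - y‖⁻¹ ^ p + ‖x - y‖⁻¹ ^ p) * |f y|) := by ring
      _ = _ := by rw [ht', one_mul]
  have hcont : Tendsto (fun t : ℝ => ‖t • v‖) (𝓝[≠] 0) (𝓝 0) := by
    have : Tendsto (fun t : ℝ => ‖t • v‖) (𝓝 0) (𝓝 ‖(0 : ℝ) • v‖) :=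
      Continuous.tendsto (by fun_prop) 0
    rw [zero_smul, norm_zero] at this
    exact this.mono_left nhdsWithin_le_nhds
  have hsplit : ∀ t, t⁻¹ * ∫ y, (k (x + t • v - y) - k (x - y)) * f y
      = (∫ y in A t, D t y) + ∫ y, (A t)ᶜ.indicator (D t) y := by
    intro t
    rw [integral_indicator measurableSet_ball.compl, integral_add_compl measurableSet_ball (hDi t),
      integral_const_mul]
  have hfar : Tendsto (fun t => ∫ y, (A t)ᶜ.indicator (D t) y) (𝓝[≠] 0)
      (𝓝 (∫ y, K (x - y) * f y)) := by
    refine tendsto_integral_filter_of_dominated_convergence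
      (fun y => C * ‖v‖ * (2 ^ p + 1) * (‖x - y‖⁻¹ ^ p * |f y|)) ?_ ?_ ?_ ?_
    · exact Eventually.of_forall fun t =>
        (hDi t).aestronglyMeasurable.indicator measurableSet_ball.compl
    · filter_upwards [self_mem_nhdsWithin] with t ht
      filter_upwards [Measure.ae_ne volume x, Measure.ae_ne volume (x + t • v)] with y hy hy'
      by_cases hyA : y ∈ A t
      · rw [Set.indicator_of_notMem (by simpa using hyA), norm_zero]
        positivity
      · rw [Set.indicator_of_mem (by simpa using hyA), Real.norm_eq_abs]
        refine (hDb t ht y hy hy').trans ?_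
        have h1 : 2 * ‖t • v‖ ≤ ‖x - y‖ := by
          simpa [hA, dist_eq_norm, norm_sub_rev] using hyA
        have h2 : ‖x - y‖ ≤ ‖x + t • v - y‖ + ‖t • v‖ := by
          have := norm_sub_le (x + t • v - y) (t • v)
          rwa [show x + t • v - y - t • v = x - y by abel] at this
        have h3 : 0 < ‖x - y‖ := norm_pos_iff.2 (sub_ne_zero.2 hy.symm)
        have h4 : ‖x + t • v - y‖⁻¹ ≤ 2 * ‖x - y‖⁻¹ := by
          have : ‖x - y‖ / 2 ≤ ‖x + t • v - y‖ := by linarith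
          calc _ ≤ (‖x - y‖ / 2)⁻¹ := inv_anti₀ (by positivity) this
            _ = _ := by rw [inv_div]; ring
        calc C * ‖v‖ * (‖x + t • v - y‖⁻¹ ^ p + ‖x - y‖⁻¹ ^ p) * |f y|
            ≤ C * ‖v‖ * ((2 * ‖x - y‖⁻¹) ^ p + ‖x - y‖⁻¹ ^ p) * |f y| := by gcongr
          _ = _ := by rw [mul_pow]; ring
    · exact (integrable_inv_norm_sub_pow_mul hp hf.abs hfi.abs x).const_mul _
    · filter_upwards [Measure.ae_ne volume x] with y hy
      have h := (hK (x - y) (sub_ne_zero.2 hy.symm))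
      rw [HasLineDerivAt, hasDerivAt_iff_tendsto_slope_zero] at h
      refine (h.mul_const (f y)).congr' ?_
      have h3 : 0 < ‖x - y‖ := norm_pos_iff.2 (sub_ne_zero.2 hy.symm)
      filter_upwards [hcont.eventually (gt_mem_nhds (show 0 < ‖x - y‖ / 2 by positivity))] with t ht
      have hyA : y ∈ (A t)ᶜ := by
        simp only [hA, Set.mem_compl_iff, mem_ball, dist_eq_norm, norm_sub_rev y x]
        linarith
      rw [Set.indicator_of_mem hyA, hD]
      simp only [zero_add, zero_smul, add_zero, smul_eq_mul]
      rw [show x - y + t • v = x + t • v - y by abel]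
      ring
  have hnear : Tendsto (fun t => ∫ y in A t, D t y) (𝓝[≠] 0) (𝓝 0) := by
    set W : ℝ → ℝ := fun r => ∫ z in ball (0 : RSpace n) r, ‖z‖⁻¹ ^ p with hW
    have hW0 : ∀ c : ℝ, Tendsto (fun t : ℝ => W (c * ‖t • v‖)) (𝓝[≠] 0) (𝓝 0) := by
      intro c
      refine (tendsto_setIntegral_ball_inv_norm_pow hp).comp ?_
      simpa using hcont.const_mul c
    have hlim : Tendsto (fun t : ℝ => C * ‖v‖ * M * (W (3 * ‖t • v‖) + W (2 * ‖t • v‖)))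
        (𝓝[≠] 0) (𝓝 0) := by
      simpa using ((hW0 3).add (hW0 2)).const_mul (C * ‖v‖ * M)
    refine squeeze_zero_norm' ?_ hlim
    filter_upwards [self_mem_nhdsWithin, hcont.eventually (gt_mem_nhds
      (show (0 : ℝ) < 1 / 2 by norm_num))] with t ht ht'
    -- Recentring at the other singularity costs one more `‖t • v‖` of radius.
    have hsub : A t ⊆ ball (x + t • v) (3 * ‖t • v‖) := by
      refine ball_subset_ball' ?_
      rw [dist_eq_norm, sub_add_cancel_left, norm_neg]
      linarith
    have i1 := integrableOn_ball_inv_norm_sub_pow hp (x + t • v) (3 * ‖t • v‖)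
    have i2 := integrableOn_ball_inv_norm_sub_pow hp x (2 * ‖t • v‖)
    calc ‖∫ y in A t, D t y‖
        ≤ ∫ y in A t, C * ‖v‖ * M * (‖x + t • v - y‖⁻¹ ^ p + ‖x - y‖⁻¹ ^ p) := by
          refine norm_integral_le_of_norm_le (((i1.mono_set hsub).add i2).const_mul _) ?_
          filter_upwards [ae_restrict_mem measurableSet_ball,
            ae_restrict_of_ae (Measure.ae_ne volume x),
            ae_restrict_of_ae (Measure.ae_ne volume (x + t • v))] with y hyA hy hy'
          refine (hDb t ht y hy hy').trans ?_
          have : |f y| ≤ M := hM y (ball_subset_ball (by linarith) hyA)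
          calc C * ‖v‖ * (‖x + t • v - y‖⁻¹ ^ p + ‖x - y‖⁻¹ ^ p) * |f y|
              ≤ C * ‖v‖ * (‖x + t • v - y‖⁻¹ ^ p + ‖x - y‖⁻¹ ^ p) * M := by gcongr
            _ = _ := by ring
      _ = C * ‖v‖ * M * ((∫ y in A t, ‖x + t • v - y‖⁻¹ ^ p) + ∫ y in A t, ‖x - y‖⁻¹ ^ p) := by
          rw [integral_const_mul, integral_add (i1.mono_set hsub) i2]
      _ ≤ _ := by
          rw [setIntegral_ball_inv_norm_sub_pow x]
          have : ∫ y in A t, ‖x + t • v - y‖⁻¹ ^ p ≤ W (3 * ‖t • v‖) := by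
            rw [hW]
            beta_reduce
            rw [← setIntegral_ball_inv_norm_sub_pow (x + t • v)]
            exact setIntegral_mono_set i1 (Eventually.of_forall fun _ => by positivity)
              hsub.eventuallyLE
          gcongr
  have := hnear.add hfar
  rw [zero_add] at this
  exact this.congr fun t => (hsplit t).symm

/-- From `log t ≤ t - 1` at `t = ‖a‖ / ‖b‖` and at its inverse. The form is the one
`integrable_slope_mul` asks for, with `p = 1`. -/
theorem abs_log_norm_sub_log_norm_le {a b : RSpace n} (ha : a ≠ 0) (hb : b ≠ 0) :
    |Real.log ‖a‖ - Real.log ‖b‖| ≤ 1 * ‖a - b‖ * (‖a‖⁻¹ ^ 1 + ‖b‖⁻¹ ^ 1) := by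
  have key : ∀ a b : RSpace n, a ≠ 0 → b ≠ 0 →
      Real.log ‖a‖ - Real.log ‖b‖ ≤ ‖a - b‖ * ‖b‖⁻¹ := by
    intro a b ha hb
    have ha' := norm_pos_iff.2 ha
    have hb' := norm_pos_iff.2 hb
    rw [← Real.log_div ha'.ne' hb'.ne']
    calc _ ≤ ‖a‖ / ‖b‖ - 1 := Real.log_le_sub_one_of_pos (by positivity)
      _ = (‖a‖ - ‖b‖) * ‖b‖⁻¹ := by field_simp
      _ ≤ _ := by gcongr; exact norm_sub_norm_le a b
  have h1 := key a b ha hb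
  have h2 := key b a hb ha
  rw [norm_sub_rev] at h2
  have h3 : 0 ≤ ‖a - b‖ * ‖a‖⁻¹ := by positivity
  have h4 : 0 ≤ ‖a - b‖ * ‖b‖⁻¹ := by positivity
  rw [abs_le]
  constructor <;> nlinarith

/-- The inversion kernel `z / |z|²`, the gradient of `log |z|`. -/
noncomputable def invKernel (z : RSpace n) : RSpace n := (‖z‖⁻¹ ^ 2) • z

theorem measurable_invKernel : Measurable (invKernel : RSpace n → RSpace n) := by
  unfold invKernel; fun_prop

theorem norm_invKernel (z : RSpace n) : ‖invKernel z‖ = ‖z‖⁻¹ := by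
  rw [invKernel, norm_smul, Real.norm_of_nonneg (by positivity)]
  rcases eq_or_ne z 0 with rfl | hz
  · simp
  · have := norm_ne_zero_iff.2 hz
    field_simp

theorem norm_invKernel_sub {a b : RSpace n} (ha : a ≠ 0) (hb : b ≠ 0) :
    ‖invKernel a - invKernel b‖ = ‖a - b‖ * (‖a‖⁻¹ * ‖b‖⁻¹) := by
  have := dist_div_norm_sq_smul ha hb 1
  simp only [one_div, one_pow, dist_eq_norm] at this
  rw [invKernel, invKernel, this, mul_inv]
  ring

/-- Inversion distorts distances by exactly `1 / (‖a‖ ‖b‖)`, and `2st ≤ s² + t²` separates the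
factors. This is the slope bound with `p = 2` used for second derivatives. -/
theorem abs_inner_invKernel_sub_le (e : RSpace n) {a b : RSpace n} (ha : a ≠ 0) (hb : b ≠ 0) :
    |inner ℝ (invKernel a) e - inner ℝ (invKernel b) e|
      ≤ ‖e‖ * ‖a - b‖ * (‖a‖⁻¹ ^ 2 + ‖b‖⁻¹ ^ 2) := by
  rw [← inner_sub_left]
  refine (abs_real_inner_le_norm _ _).trans ?_
  rw [norm_invKernel_sub ha hb, mul_comm, mul_assoc]
  gcongr
  nlinarith [sq_nonneg (‖a‖⁻¹ - ‖b‖⁻¹), sq_nonneg (‖a‖⁻¹ + ‖b‖⁻¹)]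

theorem hasFDerivAt_log_norm {z : RSpace n} (hz : z ≠ 0) :
    HasFDerivAt (fun z : RSpace n => Real.log ‖z‖) (innerSL ℝ (invKernel z)) z := by
  have hz' := norm_ne_zero_iff.2 hz
  have h := ((hasStrictFDerivAt_norm_sq z).hasFDerivAt.log (by positivity)).const_mul (1 / 2)
  have e : (fun z : RSpace n => 1 / 2 * Real.log (‖z‖ ^ 2)) = fun z => Real.log ‖z‖ := by
    funext y; rw [Real.log_pow]; push_cast; ring
  rw [e] at h
  refine h.congr_fderiv (ContinuousLinearMap.ext fun v => ?_)
  simp [invKernel]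
  ring

theorem hasLineDerivAt_inner_invKernel (e : RSpace n) {z : RSpace n} (hz : z ≠ 0) :
    HasLineDerivAt ℝ (fun z => inner ℝ (invKernel z) e)
      (‖z‖⁻¹ ^ 2 * ‖e‖ ^ 2 - 2 * inner ℝ z e ^ 2 * ‖z‖⁻¹ ^ 4) z e := by
  have hz' := norm_ne_zero_iff.2 hz
  have h1 := (hasStrictFDerivAt_norm_sq z).hasFDerivAt
  have h2 : HasFDerivAt (fun z : RSpace n => inner ℝ z e) (innerSL ℝ e) z := by
    convert (innerSL ℝ e).hasFDerivAt using 1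
    funext y
    simp [real_inner_comm]
  have h3 := ((hasDerivAt_inv (by positivity)).comp_hasFDerivAt z h1).mul h2
  have e1 : (fun z : RSpace n => inner ℝ (invKernel z) e)
      = (fun z => (‖z‖ ^ 2)⁻¹ ) * fun z => inner ℝ z e := by
    funext y; simp [invKernel, inner_smul_left]
  rw [e1]
  have e2 : ‖z‖⁻¹ ^ 2 * ‖e‖ ^ 2 - 2 * inner ℝ z e ^ 2 * ‖z‖⁻¹ ^ 4 =
      ((‖z‖ ^ 2)⁻¹ • innerSL ℝ e
        + inner ℝ z e • -((‖z‖ ^ 2) ^ 2)⁻¹ • 2 • innerSL ℝ z) e := by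
    simp
    field_simp
    ring
  rw [e2]
  exact h3.hasLineDerivAt e

variable {u f : RSpace n → ℝ} {c C : ℝ}

theorem integrable_log_mul (hn : 1 < n) (hf : Continuous f) (hfi : Integrable f) (x : RSpace n) :
    Integrable (fun y => Real.log (‖y‖ / ‖x - y‖) * f y) := by
  have := RSpace.nontrivial (n := n) (by omega)
  -- Taking the second base point to be `0` produces `log ‖y‖ - log ‖x - y‖`.
  refine (integrable_slope_mul hn (Real.measurable_log.comp measurable_norm)
    (fun a b => abs_log_norm_sub_log_norm_le) hf hfi x 0).congr ?_
  filter_upwards [Measure.ae_ne volume x, Measure.ae_ne volume 0] with y hy hy0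
  rw [Real.log_div (norm_ne_zero_iff.2 hy0) (norm_ne_zero_iff.2 (sub_ne_zero.2 hy.symm))]
  simp

theorem fderiv_logPotential (hn : 1 < n) (hf : Continuous f) (hfi : Integrable f)
    (hu : ∀ x, u x = c * (∫ y, Real.log (‖y‖ / ‖x - y‖) * f y) + C) (hud : Differentiable ℝ u)
    (x v : RSpace n) :
    fderiv ℝ u x v = -c * ∫ y, inner ℝ (invKernel (x - y)) v * f y := by
  have := RSpace.nontrivial (n := n) (by omega)
  have h1 := (tendsto_integral_slope_mul hn zero_le_one (v := v)
    (Real.measurable_log.comp measurable_norm)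
    (fun a b => abs_log_norm_sub_log_norm_le)
    (fun z hz => (hasFDerivAt_log_norm hz).hasLineDerivAt v) hf hfi x).const_mul (-c)
  have h2 := (hud x).hasFDerivAt.hasLineDerivAt v
  rw [HasLineDerivAt, hasDerivAt_iff_tendsto_slope_zero] at h2
  refine tendsto_nhds_unique (h2.congr fun t => ?_) h1
  simp only [zero_add, zero_smul, add_zero, smul_eq_mul, hu]
  rw [mul_left_comm, add_sub_add_right_eq_sub, ← mul_sub,
    ← integral_sub (integrable_log_mul hn hf hfi _) (integrable_log_mul hn hf hfi _),
    neg_mul, ← mul_neg, ← integral_neg]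
  congr 2
  refine integral_congr_ae ?_
  filter_upwards [Measure.ae_ne volume x, Measure.ae_ne volume (x + t • v),
    Measure.ae_ne volume 0] with y hy hy' hy0
  rw [Real.log_div (norm_ne_zero_iff.2 hy0) (norm_ne_zero_iff.2 (sub_ne_zero.2 hy.symm)),
    Real.log_div (norm_ne_zero_iff.2 hy0) (norm_ne_zero_iff.2 (sub_ne_zero.2 hy'.symm))]
  simp only [Function.comp]
  ring

theorem integrable_inner_invKernel_mul (hn : 1 < n) (hf : Continuous f) (hfi : Integrable f)
    (x v : RSpace n) : Integrable (fun y => inner ℝ (invKernel (x - y)) v * f y) := by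
  refine ((integrable_inv_norm_sub_pow_mul hn hf.abs hfi.abs x).const_mul ‖v‖).mono' ?_ ?_
  · exact ((measurable_invKernel.comp (by fun_prop)).inner_const.mul
      hf.measurable).aestronglyMeasurable
  · refine Eventually.of_forall fun y => ?_
    rw [norm_mul, Real.norm_eq_abs, Real.norm_eq_abs]
    calc _ ≤ ‖invKernel (x - y)‖ * ‖v‖ * |f y| := by
          gcongr; exact abs_real_inner_le_norm _ _
      _ = _ := by rw [norm_invKernel]; ring

theorem partialDeriv_partialDeriv_logPotential (hn : 2 < n) (hf : Continuous f)
    (hfi : Integrable f)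
    (hu : ∀ x, u x = c * (∫ y, Real.log (‖y‖ / ‖x - y‖) * f y) + C) (hud : ContDiff ℝ ∞ u)
    (i : Fin n) (x : RSpace n) :
    partialDeriv i (partialDeriv i u) x =
      -c * ∫ y, (‖x - y‖⁻¹ ^ 2 - 2 * (x - y) i ^ 2 * ‖x - y‖⁻¹ ^ 4) * f y := by
  set e : RSpace n := EuclideanSpace.single i 1 with he
  have h1 := (tendsto_integral_slope_mul hn (norm_nonneg e) (v := e)
    measurable_invKernel.inner_const (fun a b => abs_inner_invKernel_sub_le e)
    (fun z hz => hasLineDerivAt_inner_invKernel e hz) hf hfi x).const_mul (-c)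
  have h2 := (((hud.partialDeriv i).differentiable_infty) x).hasFDerivAt.hasLineDerivAt e
  rw [HasLineDerivAt, hasDerivAt_iff_tendsto_slope_zero] at h2
  have h3 := tendsto_nhds_unique (h2.congr fun t => ?_) h1
  · rw [partialDeriv, ← he, h3]
    simp [he, EuclideanSpace.inner_single_right]
  · have hpd : ∀ x, partialDeriv i u x = -c * ∫ y, inner ℝ (invKernel (x - y)) e * f y := fun x =>
      fderiv_logPotential (by omega) hf hfi hu hud.differentiable_infty x e
    simp only [zero_add, zero_smul, add_zero, smul_eq_mul, hpd]
    rw [mul_left_comm, ← mul_sub, ← integral_sub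
      (integrable_inner_invKernel_mul (by omega) hf hfi _ _)
      (integrable_inner_invKernel_mul (by omega) hf hfi _ _)]
    simp only [sub_mul]

/-- Tracing the Hessian of the kernel: `Δ log |z| = (n - 2) / |z|²`, which is locally integrable
because `2 < n`. -/
theorem sum_partialDeriv_partialDeriv_logPotential (hn : 2 < n) (hf : Continuous f)
    (hfi : Integrable f)
    (hu : ∀ x, u x = c * (∫ y, Real.log (‖y‖ / ‖x - y‖) * f y) + C) (hud : ContDiff ℝ ∞ u)
    (x : RSpace n) :
    ∑ i, partialDeriv i (partialDeriv i u) x = -(c * (n - 2)) * ∫ y, ‖x - y‖⁻¹ ^ 2 * f y := by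
  simp only [partialDeriv_partialDeriv_logPotential hn hf hfi hu hud]
  rw [← Finset.mul_sum, ← integral_finsetSum, ← integral_const_mul, ← integral_const_mul]
  · congr 1
    funext y
    rw [← Finset.sum_mul, Finset.sum_sub_distrib, ← Finset.sum_mul, ← Finset.mul_sum,
      ← EuclideanSpace.real_norm_sq_eq]
    rcases eq_or_ne (x - y) 0 with h | h
    · simp [h]
    · have := norm_ne_zero_iff.2 h
      simp
      field_simp
  · intro i _
    refine ((integrable_inv_norm_sub_pow_mul hn hf.abs hfi.abs x).const_mul 3).mono' ?_ ?_
    · exact (Measurable.mul (by fun_prop) hf.measurable).aestronglyMeasurable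
    · refine Eventually.of_forall fun y => ?_
      rw [norm_mul, Real.norm_eq_abs, Real.norm_eq_abs, ← mul_assoc]
      refine mul_le_mul_of_nonneg_right ?_ (abs_nonneg _)
      have h1 : (x - y) i ^ 2 * ‖x - y‖⁻¹ ^ 4 ≤ ‖x - y‖⁻¹ ^ 2 := by
        have : (x - y) i ^ 2 ≤ ‖x - y‖ ^ 2 := by
          rw [← sq_abs]
          gcongr
          exact PiLp.norm_apply_le (x - y) i
        calc _ ≤ ‖x - y‖ ^ 2 * ‖x - y‖⁻¹ ^ 4 := by gcongr
          _ = ‖x - y‖⁻¹ ^ 2 := by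
            rcases eq_or_ne (x - y) 0 with h | h
            · simp [h]
            · have := norm_ne_zero_iff.2 h
              field_simp
      have h2 : 0 ≤ (x - y) i ^ 2 * ‖x - y‖⁻¹ ^ 4 := by positivity
      have h3 : 0 ≤ ‖x - y‖⁻¹ ^ 2 := by positivity
      rw [abs_le]
      constructor <;> linarith

end Potential

/-! ### Polar coordinates and sphere averages of singular kernels -/

section Sphere

variable {n : ℕ}

/-- The area measure of the unit sphere of `ℝⁿ`. -/
noncomputable abbrev sphereMeasure (n : ℕ) : Measure (sphere (0 : RSpace n) 1) :=
  (volume : Measure (RSpace n)).toSphere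

theorem lintegral_volumeIoiPow (m : ℕ) {g : ℝ → ENNReal} (hg : Measurable g) :
    ∫⁻ r : Set.Ioi (0 : ℝ), g r ∂Measure.volumeIoiPow m
      = ∫⁻ r in Set.Ioi (0 : ℝ), ENNReal.ofReal (r ^ m) * g r := by
  rw [Measure.volumeIoiPow, lintegral_withDensity_eq_lintegral_mul _ (by fun_prop) (by fun_prop)]
  exact lintegral_subtype_comap measurableSet_Ioi fun r : ℝ => ENNReal.ofReal (r ^ m) * g r

theorem lintegral_eq_lintegral_sphere_prod (hn : 0 < n) {g : RSpace n → ENNReal} :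
    ∫⁻ x, g x = ∫⁻ p, g ((p.2 : ℝ) • (p.1 : RSpace n))
      ∂((sphereMeasure n).prod (Measure.volumeIoiPow (n - 1))) := by
  have := RSpace.nontrivial hn
  have h := (volume : Measure (RSpace n)).measurePreserving_homeomorphUnitSphereProd
    |>.lintegral_comp_emb (Homeomorph.measurableEmbedding _)
      (fun p => g ((p.2 : ℝ) • (p.1 : RSpace n)))
  simp only [finrank_euclideanSpace, Fintype.card_fin] at h
  rw [← h]
  have e : ∀ x : ({0}ᶜ : Set (RSpace n)),
      (((homeomorphUnitSphereProd (RSpace n) x).2 : ℝ) •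
        ((homeomorphUnitSphereProd (RSpace n) x).1 : RSpace n)) = x := by
    intro x
    rw [← homeomorphUnitSphereProd_symm_apply_coe, Homeomorph.symm_apply_apply]
  simp only [e]
  rw [lintegral_subtype_comap (measurableSet_singleton _).compl, restrict_compl_singleton]

theorem lintegral_polar (hn : 0 < n) {g : RSpace n → ENNReal} (hg : Measurable g) :
    ∫⁻ x, g x = ∫⁻ w, ∫⁻ r in Set.Ioi (0 : ℝ),
      ENNReal.ofReal (r ^ (n - 1)) * g (r • (w : RSpace n)) ∂volume ∂sphereMeasure n := by
  rw [lintegral_eq_lintegral_sphere_prod hn, lintegral_prod _ (by fun_prop)]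
  congr 1
  funext w
  exact lintegral_volumeIoiPow (n - 1) (g := fun r => g (r • (w : RSpace n))) (by fun_prop)

theorem lintegral_inv_norm_pow_three_le (hn : 4 ≤ n) (s : Set (RSpace n))
    (z : RSpace n) :
    ∫⁻ x in s, ENNReal.ofReal (‖x - z‖⁻¹ ^ 3) ≤
      ENNReal.ofReal (∫ x in ball (0 : RSpace n) 1, ‖x‖⁻¹ ^ 3) + volume s := by
  have h1 : ∫⁻ x in ball z 1, ENNReal.ofReal (‖x - z‖⁻¹ ^ 3) =
      ENNReal.ofReal (∫ x in ball (0 : RSpace n) 1, ‖x‖⁻¹ ^ 3) := by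
    rw [← setIntegral_ball_inv_norm_sub_pow z,
      ofReal_integral_eq_lintegral_ofReal (integrableOn_ball_inv_norm_sub_pow (by omega) z 1)
        (Eventually.of_forall fun x => by positivity)]
    simp only [norm_sub_rev]
  rw [← lintegral_inter_add_sdiff _ s (measurableSet_ball (x := z) (ε := 1)), ← h1]
  gcongr
  · exact Set.inter_subset_right
  · calc ∫⁻ x in s \ ball z 1, ENNReal.ofReal (‖x - z‖⁻¹ ^ 3) ≤ ∫⁻ x in s \ ball z 1, 1 := by
          refine setLIntegral_mono (by fun_prop) fun x hx => ?_
          rw [← ENNReal.ofReal_one]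
          refine ENNReal.ofReal_le_ofReal (pow_le_one₀ (by positivity) (inv_le_one_of_one_le₀ ?_))
          simpa [dist_eq_norm] using hx.2
      _ ≤ volume s := by
          rw [setLIntegral_one]
          exact measure_mono Set.sdiff_subset

/-- A singularity on the sphere is traded for one in a solid shell. If `d = ‖w - z‖ < 1`, the radial
segment of length `d` starting at `w` stays within `2d` of `z`, so it contributes at least `d (2d)⁻³
= d⁻² / 8`. The summand `1` covers `d ≥ 1`. -/
theorem ofReal_inv_norm_sub_sq_le (w z : RSpace n) (hw : ‖w‖ = 1) :
    ENNReal.ofReal (‖w - z‖⁻¹ ^ 2) ≤ 1 + 8 * ∫⁻ r in Set.Ioo (1 : ℝ) 2,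
      ENNReal.ofReal (r ^ (n - 1)) * ENNReal.ofReal (‖r • w - z‖⁻¹ ^ 3) := by
  set d := ‖w - z‖ with hd
  rcases le_or_gt 1 d with h1 | h1
  · refine le_add_right ?_
    rw [← ENNReal.ofReal_one]
    exact ENNReal.ofReal_le_ofReal (pow_le_one₀ (by positivity) (inv_le_one_of_one_le₀ h1))
  rcases (norm_nonneg (w - z)).eq_or_lt' with h0 | h0
  · simp [← hd] at h0
    simp [h0]
  rw [← hd] at h0
  refine le_add_left ?_
  calc ENNReal.ofReal (d⁻¹ ^ 2) = 8 * ∫⁻ r in Set.Ioo (1 : ℝ) (1 + d),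
        ENNReal.ofReal ((2 * d)⁻¹ ^ 3) := by
        rw [setLIntegral_const, Real.volume_Ioo, ← ENNReal.ofReal_mul (by positivity),
          show (8 : ENNReal) = ENNReal.ofReal 8 by simp, ← ENNReal.ofReal_mul (by norm_num)]
        congr 1
        field_simp
        ring
    _ ≤ 8 * ∫⁻ r in Set.Ioo (1 : ℝ) (1 + d),
        ENNReal.ofReal (r ^ (n - 1)) * ENNReal.ofReal (‖r • w - z‖⁻¹ ^ 3) := by
        refine mul_le_mul' le_rfl (setLIntegral_mono' measurableSet_Ioo fun r hr => ?_)
        rw [← ENNReal.ofReal_mul (by have := hr.1; positivity)]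
        refine ENNReal.ofReal_le_ofReal ?_
        have e1 : ‖(r - 1) • w‖ = r - 1 := by
          rw [norm_smul, hw, mul_one, Real.norm_of_nonneg (by linarith [hr.1])]
        have e2 : r • w - z = (w - z) + (r - 1) • w := by rw [sub_smul, one_smul]; abel
        have h2 : ‖r • w - z‖ ≤ 2 * d := by
          have := norm_add_le (w - z) ((r - 1) • w)
          rw [e2]; linarith [hr.2]
        have h3 : 0 < ‖r • w - z‖ := by
          have := norm_sub_norm_le (w - z) (-((r - 1) • w))
          rw [sub_neg_eq_add, norm_neg, e1, ← hd, ← e2] at this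
          linarith [hr.2]
        calc (2 * d)⁻¹ ^ 3 ≤ ‖r • w - z‖⁻¹ ^ 3 := by gcongr
          _ ≤ _ := le_mul_of_one_le_left (by positivity) (one_le_pow₀ hr.1.le)
    _ ≤ _ := by
        gcongr
        linarith

/-- The bound is uniform in `z`, even for `z` on the sphere. Integrating the shell estimate over `w`
gives a volume integral of `‖x - z‖⁻³` over `ball 0 2`, finite since `3 < n`. -/
theorem exists_lintegral_sphere_inv_norm_sub_sq_le (hn : 4 ≤ n) :
    ∃ C : ENNReal, C ≠ ⊤ ∧ ∀ z : RSpace n,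
      ∫⁻ w, ENNReal.ofReal (‖(w : RSpace n) - z‖⁻¹ ^ 2) ∂sphereMeasure n ≤ C := by
  refine ⟨sphereMeasure n Set.univ + 8 * (ENNReal.ofReal (∫ x in ball (0 : RSpace n) 1, ‖x‖⁻¹ ^ 3)
    + volume (ball (0 : RSpace n) 2)), ?_, fun z => ?_⟩
  · have := (measure_ball_lt_top (μ := volume) (x := (0 : RSpace n)) (r := 2)).ne
    finiteness
  have hw : ∀ w : sphere (0 : RSpace n) 1, ‖(w : RSpace n)‖ = 1 := fun w => by simp
  calc _ ≤ ∫⁻ w, (1 + 8 * ∫⁻ r in Set.Ioo (1 : ℝ) 2, ENNReal.ofReal (r ^ (n - 1)) *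
        ENNReal.ofReal (‖r • (w : RSpace n) - z‖⁻¹ ^ 3)) ∂sphereMeasure n :=
        lintegral_mono fun w => ofReal_inv_norm_sub_sq_le _ z (hw w)
    _ = sphereMeasure n Set.univ + 8 * ∫⁻ w, ∫⁻ r in Set.Ioo (1 : ℝ) 2,
        ENNReal.ofReal (r ^ (n - 1)) * ENNReal.ofReal (‖r • (w : RSpace n) - z‖⁻¹ ^ 3)
          ∂volume ∂sphereMeasure n := by
        rw [lintegral_add_left measurable_const, lintegral_one, lintegral_const_mul' _ _ (by simp)]
    _ ≤ _ := by
        gcongr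
        refine le_trans ?_ (lintegral_inv_norm_pow_three_le hn (ball 0 2) z)
        rw [← lintegral_indicator measurableSet_ball, lintegral_polar (by omega)
          (Measurable.indicator (by fun_prop) measurableSet_ball)]
        refine lintegral_mono fun w => ?_
        refine le_trans ?_ (lintegral_mono_set fun r (hr : r ∈ Set.Ioo (1 : ℝ) 2) =>
          Set.mem_Ioi.2 (zero_lt_one.trans hr.1))
        refine setLIntegral_mono' measurableSet_Ioo fun r hr => ?_
        rw [Set.indicator_of_mem]
        rw [mem_ball_zero_iff, norm_smul, hw, mul_one, Real.norm_of_nonneg (by linarith [hr.1])]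
        exact hr.2

/-- If the sphere averages of `h(·, z)` are bounded in `z` and tend to `0` as `z → 0`, then those
of `∫ |f(y)| h(·, (y - x) / r) dy` tend to `0` as `r → ∞`. -/
theorem tendsto_lintegral_sphere_rescaled {h : RSpace n → RSpace n → ENNReal}
    (hm : Measurable (Function.uncurry h)) {C A : ENNReal} (hC : C ≠ ⊤) (hA : A ≠ ⊤)
    (hbound : ∀ z, ∫⁻ w, h (w : RSpace n) z ∂sphereMeasure n ≤ C)
    (hsmall : ∀ w z, ‖w‖ = 1 → ‖z‖ ≤ 1 / 2 → h w z ≤ A * ‖z‖ₑ)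
    {f : RSpace n → ℝ} (hf : Continuous f) (hfi : Integrable f) (x : RSpace n) :
    Tendsto (fun r : ℝ => ∫⁻ w, ∫⁻ y, ‖f y‖ₑ * h (w : RSpace n) (r⁻¹ • (y - x))
      ∂volume ∂sphereMeasure n) atTop (𝓝 0) := by
  have hmy : ∀ r : ℝ, Measurable (fun p : sphere (0 : RSpace n) 1 × RSpace n =>
      h (p.1 : RSpace n) (r⁻¹ • (p.2 - x))) := fun r =>
    hm.comp ((measurable_subtype_coe.comp measurable_fst).prodMk (by fun_prop))
  have hswap : ∀ r : ℝ, ∫⁻ w, ∫⁻ y, ‖f y‖ₑ * h (w : RSpace n) (r⁻¹ • (y - x))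
      ∂volume ∂sphereMeasure n
      = ∫⁻ y, ‖f y‖ₑ * ∫⁻ w, h (w : RSpace n) (r⁻¹ • (y - x)) ∂sphereMeasure n := by
    intro r
    rw [lintegral_lintegral_swap (((hf.measurable.comp measurable_snd).enorm.mul
      (hmy r)).aemeasurable)]
    congr 1
    funext y
    exact lintegral_const_mul' _ _ (by simp)
  simp only [hswap]
  have hz : ∀ y, Tendsto (fun r : ℝ => r⁻¹ • (y - x)) atTop (𝓝 0) := fun y => by
    simpa using (tendsto_inv_atTop_zero (𝕜 := ℝ)).smul_const (y - x)
  have hlim : ∀ y, Tendsto (fun r : ℝ => ‖f y‖ₑ *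
      ∫⁻ w, h (w : RSpace n) (r⁻¹ • (y - x)) ∂sphereMeasure n) atTop (𝓝 0) := by
    intro y
    have h1 : Tendsto (fun r : ℝ => ∫⁻ w, h (w : RSpace n) (r⁻¹ • (y - x)) ∂sphereMeasure n)
        atTop (𝓝 0) := by
      have h2 : Tendsto (fun r : ℝ => A * ‖r⁻¹ • (y - x)‖ₑ * sphereMeasure n Set.univ)
          atTop (𝓝 0) := by
        have h3 := (continuous_enorm.tendsto (0 : RSpace n)).comp (hz y)
        rw [enorm_zero] at h3
        have := ENNReal.Tendsto.mul_const (b := sphereMeasure n Set.univ)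
          (ENNReal.Tendsto.const_mul (a := A) h3 (Or.inr hA)) (Or.inr (measure_ne_top _ _))
        simpa using this
      refine tendsto_of_tendsto_of_tendsto_of_le_of_le' tendsto_const_nhds h2
        (Eventually.of_forall fun _ => zero_le) ?_
      have h4 := ((hz y).norm).eventually (ge_mem_nhds (show ‖(0 : RSpace n)‖ < 1 / 2 by simp))
      filter_upwards [h4] with r hr
      rw [← lintegral_const]
      exact lintegral_mono fun w => hsmall _ _ (by simp) hr
    simpa using ENNReal.Tendsto.const_mul h1 (Or.inr (by simp))
  -- After Tonelli the sphere averages are bounded by `C` and vanish in the limit for each fixed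
  -- `y`, so `C * |f|` dominates.
  have := tendsto_lintegral_filter_of_dominated_convergence (μ := (volume : Measure (RSpace n)))
    (F := fun (r : ℝ) y => ‖f y‖ₑ *
      ∫⁻ w, h (w : RSpace n) (r⁻¹ • (y - x)) ∂sphereMeasure n) (f := fun _ => 0) (l := atTop)
    (fun y => ‖f y‖ₑ * C) (Eventually.of_forall fun r => hf.measurable.enorm.mul
      (hmy r).lintegral_prod_left') (Eventually.of_forall fun r => Eventually.of_forall fun y => by
        gcongr; exact hbound _) ?_ (Eventually.of_forall hlim)
  · simpa using this
  · rw [lintegral_mul_const' _ _ hC]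
    exact ENNReal.mul_ne_top hfi.2.ne hC

/-- Cauchy–Schwarz for the measure `f dy`, by doubling variables and `2 h(y) h(z) ≤ h(y)² + h(z)²`;
this needs no finiteness. -/
theorem lintegral_mul_sq_le {f h : RSpace n → ENNReal} (hf : Measurable f) (hh : Measurable h) :
    (∫⁻ y, f y * h y) ^ 2 ≤ (∫⁻ y, f y) * ∫⁻ y, f y * h y ^ 2 := by
  have key : ∀ a b : ENNReal, 2 * (a * b) ≤ a ^ 2 + b ^ 2 := by
    intro a b
    rcases eq_or_ne a ⊤ with rfl | ha
    · simp
    rcases eq_or_ne b ⊤ with rfl | hb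
    · simp
    lift a to NNReal using ha
    lift b to NNReal using hb
    norm_cast
    have := two_mul_le_add_sq (a : ℝ) b
    rw [mul_assoc] at this
    exact_mod_cast this
  have hfh : Measurable (fun y => f y * h y) := hf.mul hh
  have hfh2 : Measurable (fun y => f y * h y ^ 2) := hf.mul (hh.pow_const 2)
  have h1 : (∫⁻ y, f y * h y) ^ 2 = ∫⁻ y, ∫⁻ z, (f y * h y) * (f z * h z) := by
    rw [sq, ← lintegral_mul_const _ hfh]
    simp only [lintegral_const_mul _ hfh]
  have h2 : (∫⁻ y, f y) * ∫⁻ y, f y * h y ^ 2 = ∫⁻ y, ∫⁻ z, f y * (f z * h z ^ 2) := by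
    rw [← lintegral_mul_const _ hf]
    simp only [lintegral_const_mul _ hfh2]
  have h3 : (∫⁻ y, f y) * ∫⁻ y, f y * h y ^ 2 = ∫⁻ y, ∫⁻ z, (f y * h y ^ 2) * f z := by
    rw [mul_comm, ← lintegral_mul_const _ hfh2]
    simp only [lintegral_const_mul _ hf]
  refine (ENNReal.mul_le_mul_iff_right two_ne_zero ENNReal.ofNat_ne_top).1 ?_
  calc 2 * (∫⁻ y, f y * h y) ^ 2
      = ∫⁻ y, ∫⁻ z, f y * f z * (2 * (h y * h z)) := by
        rw [h1, ← lintegral_const_mul' _ _ ENNReal.ofNat_ne_top]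
        congr 1
        funext y
        rw [← lintegral_const_mul' _ _ ENNReal.ofNat_ne_top]
        congr 1
        funext z
        ring
    _ ≤ ∫⁻ y, ∫⁻ z, (f y * (f z * h z ^ 2) + f y * h y ^ 2 * f z) := by
        refine lintegral_mono fun y => lintegral_mono fun z => ?_
        calc _ ≤ f y * f z * (h y ^ 2 + h z ^ 2) := by gcongr; exact key _ _
          _ = _ := by ring
    _ = _ := by
        simp only [lintegral_add_left (hfh2.const_mul _)]
        rw [lintegral_add_left, ← h2, ← h3, two_mul]
        simp only [lintegral_const_mul _ hfh2]
        fun_prop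

/-- The constants `3`, `2`, `10` are generous enough to cover all three error kernels of the
asymptotics at once. -/
theorem tendsto_lintegral_sphere_kernel (hn : 4 ≤ n) {h : RSpace n → RSpace n → ℝ}
    (hm : Measurable (Function.uncurry h))
    (hbig : ∀ w z, ‖w‖ = 1 → h w z ≤ 3 + 2 * ‖w - z‖⁻¹ ^ 2)
    (hsmall : ∀ w z, ‖w‖ = 1 → ‖z‖ ≤ 1 / 2 → h w z ≤ 10 * ‖z‖)
    {f : RSpace n → ℝ} (hf : Continuous f) (hfi : Integrable f) (x : RSpace n) :
    Tendsto (fun r : ℝ => ∫⁻ w, ∫⁻ y, ‖f y‖ₑ *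
      ENNReal.ofReal (h (w : RSpace n) (r⁻¹ • (y - x))) ∂volume ∂sphereMeasure n) atTop (𝓝 0) := by
  obtain ⟨C, hC, hCb⟩ := exists_lintegral_sphere_inv_norm_sub_sq_le hn
  refine tendsto_lintegral_sphere_rescaled (h := fun w z => ENNReal.ofReal (h w z))
    hm.ennreal_ofReal (C := 3 * sphereMeasure n Set.univ + 2 * C) (A := 10) ?_ (by simp) ?_ ?_
    hf hfi x
  · finiteness
  · intro z
    calc _ ≤ ∫⁻ w, (3 + 2 * ENNReal.ofReal (‖(w : RSpace n) - z‖⁻¹ ^ 2)) ∂sphereMeasure n := by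
          refine lintegral_mono fun w => (ENNReal.ofReal_le_ofReal (hbig w z (by simp))).trans ?_
          rw [ENNReal.ofReal_add (by norm_num) (by positivity), ENNReal.ofReal_mul (by norm_num)]
          simp
      _ ≤ _ := by
          rw [lintegral_add_left measurable_const, lintegral_const,
            lintegral_const_mul' _ _ (by simp)]
          gcongr
          exact hCb z
  · intro w z hw hz
    refine (ENNReal.ofReal_le_ofReal (hsmall w z hw hz)).trans (le_of_eq ?_)
    rw [ENNReal.ofReal_mul (by norm_num), ofReal_norm]
    simp

end Sphere

/-! ### Limits of `r² Δu` and `r² |∇u|²` over large spheres -/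

section Asymptotics

variable {n : ℕ}

/-- Rescaling to the unit sphere: with `z = (y - x) / r`, sending `r → ∞` moves every fixed `y` to
`z = 0`. -/
theorem add_smul_sub_eq {r : ℝ} (hr : 0 < r) (x w y : RSpace n) :
    x + r • w - y = r • (w - r⁻¹ • (y - x)) := by
  rw [smul_sub, smul_smul, mul_inv_cancel₀ hr.ne', one_smul]
  abel

theorem abs_norm_sub_one_le {w z : RSpace n} (hw : ‖w‖ = 1) : |‖w - z‖ - 1| ≤ ‖z‖ := by
  have := abs_norm_sub_norm_le (w - z) w
  rwa [hw, sub_sub_cancel_left, norm_neg] at this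

theorem inv_norm_sub_le_two {w z : RSpace n} (hw : ‖w‖ = 1) (hz : ‖z‖ ≤ 1 / 2) :
    ‖w - z‖⁻¹ ≤ 2 := by
  have := (abs_le.1 (abs_norm_sub_one_le (z := z) hw)).1
  rw [inv_le_comm₀ (by linarith) (by norm_num)]
  linarith

theorem norm_mul_inv_norm_sub_sq_le {w z : RSpace n} (hw : ‖w‖ = 1) :
    (‖z‖ * ‖w - z‖⁻¹) ^ 2 ≤ 2 + 2 * ‖w - z‖⁻¹ ^ 2 := by
  rcases (norm_nonneg (w - z)).eq_or_lt' with h | h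
  · simp [h]
  have h1 := (abs_le.1 (abs_norm_sub_one_le (z := z) hw)).1
  have h2 : ‖z‖ * ‖w - z‖⁻¹ ≤ 1 + ‖w - z‖⁻¹ := by
    have h3 : ‖z‖ ≤ ‖w - z‖ + 1 := by
      have := norm_sub_le w (w - z)
      rw [sub_sub_cancel, hw] at this
      linarith
    calc _ ≤ (‖w - z‖ + 1) * ‖w - z‖⁻¹ := by gcongr
      _ = _ := by field_simp
  calc _ ≤ (1 + ‖w - z‖⁻¹) ^ 2 := by gcongr
    _ ≤ _ := by nlinarith [sq_nonneg (1 - ‖w - z‖⁻¹)]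

theorem abs_inv_norm_sub_sq_sub_one_le {w z : RSpace n} (hw : ‖w‖ = 1) (hz : ‖z‖ ≤ 1 / 2) :
    |‖w - z‖⁻¹ ^ 2 - 1| ≤ 10 * ‖z‖ := by
  have h1 := abs_norm_sub_one_le (z := z) hw
  have h2 := inv_norm_sub_le_two hw hz
  have h3 : 0 < ‖w - z‖ := by linarith [(abs_le.1 h1).1]
  have e : ‖w - z‖⁻¹ ^ 2 - 1 = -(‖w - z‖ - 1) * (1 + ‖w - z‖⁻¹) * ‖w - z‖⁻¹ := by
    field_simp
    ring
  rw [e, abs_mul, abs_mul, abs_neg, abs_of_nonneg (show 0 ≤ 1 + ‖w - z‖⁻¹ by positivity),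
    abs_of_nonneg (show 0 ≤ ‖w - z‖⁻¹ by positivity)]
  calc _ ≤ ‖z‖ * (1 + 2) * 2 := by gcongr
    _ ≤ _ := by linarith [norm_nonneg z]

variable {f : RSpace n → ℝ}

theorem tendsto_lintegral_sphere_sq_sub_one (hn : 4 ≤ n) (hf : Continuous f) (hfi : Integrable f)
    (x : RSpace n) :
    Tendsto (fun r : ℝ => ∫⁻ w, ∫⁻ y, ‖f y‖ₑ *
      ENNReal.ofReal |‖(w : RSpace n) - r⁻¹ • (y - x)‖⁻¹ ^ 2 - 1| ∂volume ∂sphereMeasure n)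
      atTop (𝓝 0) := by
  refine tendsto_lintegral_sphere_kernel hn (h := fun w z => |‖w - z‖⁻¹ ^ 2 - 1|) ?_ ?_ ?_
    hf hfi x
  · unfold Function.uncurry; fun_prop
  · intro w z _
    have : 0 ≤ ‖w - z‖⁻¹ ^ 2 := by positivity
    rw [abs_le]
    constructor <;> linarith
  · exact fun w z hw hz => abs_inv_norm_sub_sq_sub_one_le hw hz

theorem tendsto_lintegral_sphere_norm_mul (hn : 4 ≤ n) (hf : Continuous f) (hfi : Integrable f)
    (x : RSpace n) :
    Tendsto (fun r : ℝ => ∫⁻ w, ∫⁻ y, ‖f y‖ₑ * ENNReal.ofReal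
      (‖r⁻¹ • (y - x)‖ * ‖(w : RSpace n) - r⁻¹ • (y - x)‖⁻¹) ∂volume ∂sphereMeasure n)
      atTop (𝓝 0) := by
  refine tendsto_lintegral_sphere_kernel hn (h := fun w z => ‖z‖ * ‖w - z‖⁻¹) ?_ ?_ ?_ hf hfi x
  · unfold Function.uncurry; fun_prop
  · intro w z hw
    nlinarith [norm_mul_inv_norm_sub_sq_le (z := z) hw, sq_nonneg (‖z‖ * ‖w - z‖⁻¹ - 1),
      sq_nonneg (‖z‖ * ‖w - z‖⁻¹)]
  · intro w z hw hz
    nlinarith [inv_norm_sub_le_two hw hz, norm_nonneg z]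

theorem tendsto_lintegral_sphere_norm_mul_sq (hn : 4 ≤ n) (hf : Continuous f)
    (hfi : Integrable f) (x : RSpace n) :
    Tendsto (fun r : ℝ => ∫⁻ w, ∫⁻ y, ‖f y‖ₑ * ENNReal.ofReal
      ((‖r⁻¹ • (y - x)‖ * ‖(w : RSpace n) - r⁻¹ • (y - x)‖⁻¹) ^ 2) ∂volume ∂sphereMeasure n)
      atTop (𝓝 0) := by
  refine tendsto_lintegral_sphere_kernel hn (h := fun w z => (‖z‖ * ‖w - z‖⁻¹) ^ 2) ?_ ?_ ?_
    hf hfi x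
  · unfold Function.uncurry; fun_prop
  · intro w z hw
    linarith [norm_mul_inv_norm_sub_sq_le (z := z) hw]
  · intro w z hw hz
    have h1 := inv_norm_sub_le_two hw hz
    calc (‖z‖ * ‖w - z‖⁻¹) ^ 2 ≤ (‖z‖ * 2) ^ 2 := by gcongr
      _ ≤ _ := by nlinarith [norm_nonneg z]

variable {u : RSpace n → ℝ} {c C : ℝ}

theorem integral_sphere_const (a : ℝ) :
    ∫ _w, a ∂sphereMeasure n = (sphereMeasure n).real Set.univ * a := by
  rw [integral_const, smul_eq_mul]

/-- After rescaling, `r² |x + r w - y|⁻²` becomes `|w - z|⁻²`, whose deviation from its value `1` at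
`z = 0` is small in `L¹` of the sphere, weighted by `f`. -/
theorem tendsto_sphere_laplacian (hn : 4 ≤ n) (hf : Continuous f) (hfi : Integrable f)
    (hu : ∀ x, u x = c * (∫ y, Real.log (‖y‖ / ‖x - y‖) * f y) + C) (hud : ContDiff ℝ ∞ u)
    (x : RSpace n) :
    Tendsto (fun r : ℝ => ∫ w, r ^ 2 * ∑ i, partialDeriv i (partialDeriv i u)
        (x + r • (w : RSpace n)) ∂sphereMeasure n) atTop
      (𝓝 ((sphereMeasure n).real Set.univ * (-(c * (n - 2)) * ∫ y, f y))) := by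
  rw [← integral_sphere_const]
  have hcont : Continuous (fun x => ∑ i, partialDeriv i (partialDeriv i u) x) :=
    continuous_finsetSum _ fun i _ => ((hud.partialDeriv i).partialDeriv i).continuous
  have hint : ∀ r : ℝ, Integrable (fun w : sphere (0 : RSpace n) 1 =>
      r ^ 2 * ∑ i, partialDeriv i (partialDeriv i u) (x + r • (w : RSpace n)))
      (sphereMeasure n) := fun r =>
    (continuous_const.mul (hcont.comp (by fun_prop))).integrable_of_hasCompactSupport
      (HasCompactSupport.of_compactSpace _)
  refine tendsto_integral_of_L1 _ aestronglyMeasurable_const (Eventually.of_forall hint) ?_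
  have hlim := ENNReal.Tendsto.const_mul (a := ‖c * (n - 2)‖ₑ)
    (tendsto_lintegral_sphere_sq_sub_one hn hf hfi x) (Or.inr enorm_ne_top)
  rw [mul_zero] at hlim
  refine tendsto_of_tendsto_of_tendsto_of_le_of_le' tendsto_const_nhds hlim
    (Eventually.of_forall fun _ => zero_le) ?_
  filter_upwards [eventually_gt_atTop 0] with r hr
  rw [← lintegral_const_mul' _ _ enorm_ne_top]
  refine lintegral_mono fun w => ?_
  have e : r ^ 2 * ∑ i, partialDeriv i (partialDeriv i u) (x + r • (w : RSpace n))
      - -(c * (n - 2)) * ∫ y, f y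
      = -(c * (n - 2)) * ∫ y, f y * (‖(w : RSpace n) - r⁻¹ • (y - x)‖⁻¹ ^ 2 - 1) := by
    rw [sum_partialDeriv_partialDeriv_logPotential (by omega) hf hfi hu hud, mul_left_comm,
      ← mul_sub, ← integral_const_mul, ← integral_sub
        ((integrable_inv_norm_sub_pow_mul (by omega) hf hfi _).const_mul _) hfi]
    congr 2
    funext y
    rw [add_smul_sub_eq hr, norm_smul, Real.norm_of_nonneg hr.le]
    field_simp
  rw [e, enorm_mul, enorm_neg]
  gcongr
  refine (enorm_integral_le_lintegral_enorm _).trans (lintegral_mono fun y => ?_)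
  rw [enorm_mul, ← Real.enorm_eq_ofReal_abs]

theorem inner_gradient_eq_fderiv (u : RSpace n → ℝ) (x v : RSpace n) :
    inner ℝ (∇ u x) v = fderiv ℝ u x v := by
  rw [← toDual_gradient, InnerProductSpace.toDual_apply_apply]

theorem sum_partialDeriv_sq (u : RSpace n → ℝ) (x : RSpace n) :
    ∑ i, partialDeriv i u x ^ 2 = ‖∇ u x‖ ^ 2 := by
  rw [EuclideanSpace.real_norm_sq_eq]
  refine Finset.sum_congr rfl fun i _ => ?_
  rw [partialDeriv, ← inner_gradient_eq_fderiv, EuclideanSpace.inner_single_right]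
  simp

theorem integrable_smul_invKernel (hn : 1 < n) (hf : Continuous f) (hfi : Integrable f)
    (x : RSpace n) : Integrable (fun y => f y • invKernel (x - y)) := by
  refine (integrable_inv_norm_sub_pow_mul hn hf.abs hfi.abs x).mono' ?_ ?_
  · exact (hf.measurable.smul (measurable_invKernel.comp (by fun_prop))).aestronglyMeasurable
  · refine Eventually.of_forall fun y => ?_
    rw [norm_smul, norm_invKernel, Real.norm_eq_abs, pow_one, mul_comm]

theorem gradient_logPotential (hn : 1 < n) (hf : Continuous f) (hfi : Integrable f)
    (hu : ∀ x, u x = c * (∫ y, Real.log (‖y‖ / ‖x - y‖) * f y) + C) (hud : Differentiable ℝ u)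
    (x : RSpace n) :
    ∇ u x = -c • ∫ y, f y • invKernel (x - y) := by
  refine ext_inner_right ℝ fun v => ?_
  rw [inner_gradient_eq_fderiv, fderiv_logPotential hn hf hfi hu hud, real_inner_smul_left,
    real_inner_comm, ← integral_inner (integrable_smul_invKernel hn hf hfi x)]
  congr 2
  funext y
  rw [real_inner_smul_right, real_inner_comm, mul_comm]

theorem smul_invKernel_smul {r : ℝ} (hr : 0 < r) (z : RSpace n) :
    r • invKernel (r • z) = invKernel z := by
  rw [invKernel, invKernel, norm_smul, Real.norm_of_nonneg hr.le, smul_smul, smul_smul]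
  congr 1
  field_simp

/-- Unit vectors are fixed by the inversion, so its exact distance formula applies. -/
theorem norm_invKernel_sub_sub_self_le {w z : RSpace n} (hw : ‖w‖ = 1) (h : w ≠ z) :
    ‖invKernel (w - z) - w‖ = ‖z‖ * ‖w - z‖⁻¹ := by
  have hw0 : w ≠ 0 := by rintro rfl; simp at hw
  have e : invKernel w = w := by simp [invKernel, hw]
  have := norm_invKernel_sub (sub_ne_zero.2 h) hw0
  rw [e, sub_sub_cancel_left, norm_neg, hw] at this
  simpa using this

theorem enorm_smul_gradient_add_le (hn : 1 < n) (hf : Continuous f) (hfi : Integrable f)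
    (hu : ∀ x, u x = c * (∫ y, Real.log (‖y‖ / ‖x - y‖) * f y) + C) (hud : Differentiable ℝ u)
    (x : RSpace n) {w : RSpace n} (hw : ‖w‖ = 1) {r : ℝ} (hr : 0 < r) :
    ‖r • ∇ u (x + r • w) + (c * ∫ y, f y) • w‖ₑ ≤
      ‖c‖ₑ * ∫⁻ y, ‖f y‖ₑ * ENNReal.ofReal (‖r⁻¹ • (y - x)‖ * ‖w - r⁻¹ • (y - x)‖⁻¹) := by
  have := RSpace.nontrivial (n := n) (by omega)
  have e : r • ∇ u (x + r • w) + (c * ∫ y, f y) • w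
      = -c • ∫ y, f y • (invKernel (w - r⁻¹ • (y - x)) - w) := by
    have e1 : ∀ y, f y • (invKernel (w - r⁻¹ • (y - x)) - w)
        = r • f y • invKernel (x + r • w - y) - f y • w := by
      intro y
      rw [add_smul_sub_eq hr, smul_comm r, smul_invKernel_smul hr, smul_sub]
    simp only [e1]
    rw [integral_sub ((integrable_smul_invKernel hn hf hfi _).fun_smul r) (hfi.smul_const w),
      integral_smul, integral_smul_const, gradient_logPotential hn hf hfi hu hud]
    module
  rw [e, enorm_smul, enorm_neg]
  gcongr
  refine (enorm_integral_le_lintegral_enorm _).trans (lintegral_mono_ae ?_)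
  filter_upwards [Measure.ae_ne volume (x + r • w)] with y hy
  rw [enorm_smul]
  have hne : w ≠ r⁻¹ • (y - x) := by
    rintro h
    apply hy
    rw [h, smul_smul, mul_inv_cancel₀ hr.ne', one_smul]
    abel
  rw [← norm_invKernel_sub_sub_self_le hw hne, ofReal_norm]

theorem tendsto_sphere_gradient_sq (hn : 4 ≤ n) (hf : Continuous f) (hfi : Integrable f)
    (hu : ∀ x, u x = c * (∫ y, Real.log (‖y‖ / ‖x - y‖) * f y) + C) (hud : ContDiff ℝ ∞ u)
    (x : RSpace n) :
    Tendsto (fun r : ℝ => ∫ w, r ^ 2 * ∑ i, partialDeriv i u (x + r • (w : RSpace n)) ^ 2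
        ∂sphereMeasure n) atTop
      (𝓝 ((sphereMeasure n).real Set.univ * (c * ∫ y, f y) ^ 2)) := by
  rw [← integral_sphere_const]
  set α := c * ∫ y, f y with hα
  have hcont : Continuous (fun x => ∑ i, partialDeriv i u x ^ 2) :=
    continuous_finsetSum _ fun i _ => (hud.partialDeriv i).continuous.pow 2
  have hint : ∀ r : ℝ, Integrable (fun w : sphere (0 : RSpace n) 1 =>
      r ^ 2 * ∑ i, partialDeriv i u (x + r • (w : RSpace n)) ^ 2)
      (sphereMeasure n) := fun r =>
    (continuous_const.mul (hcont.comp (by fun_prop))).integrable_of_hasCompactSupport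
      (HasCompactSupport.of_compactSpace _)
  refine tendsto_integral_of_L1 _ aestronglyMeasurable_const (Eventually.of_forall hint) ?_
  have hlim := ((ENNReal.Tendsto.const_mul (a := ‖c‖ₑ ^ 2 * ∫⁻ y, ‖f y‖ₑ)
    (tendsto_lintegral_sphere_norm_mul_sq hn hf hfi x)
    (Or.inr (ENNReal.mul_ne_top (by simp) hfi.2.ne))).add
    (ENNReal.Tendsto.const_mul (a := 2 * ‖α‖ₑ * ‖c‖ₑ)
      (tendsto_lintegral_sphere_norm_mul hn hf hfi x)
      (Or.inr (ENNReal.mul_ne_top (ENNReal.mul_ne_top (by simp) (by simp)) (by simp)))))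
  rw [mul_zero, mul_zero, add_zero] at hlim
  refine tendsto_of_tendsto_of_tendsto_of_le_of_le' tendsto_const_nhds hlim
    (Eventually.of_forall fun _ => zero_le) ?_
  filter_upwards [eventually_gt_atTop 0] with r hr
  have hfin : ‖c‖ₑ ^ 2 * ∫⁻ y, ‖f y‖ₑ ≠ ⊤ := ENNReal.mul_ne_top (by simp) hfi.2.ne
  have hfin' : 2 * ‖α‖ₑ * ‖c‖ₑ ≠ ⊤ := ENNReal.mul_ne_top (ENNReal.mul_ne_top (by simp) (by simp))
    (by simp)
  rw [← lintegral_const_mul' _ _ hfin, ← lintegral_const_mul' _ _ hfin', ← lintegral_add_left]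
  · refine lintegral_mono fun w => ?_
    have hw : ‖(w : RSpace n)‖ = 1 := by simp
    rw [sum_partialDeriv_sq]
    set a := r • ∇ u (x + r • (w : RSpace n)) with ha
    have hG := enorm_smul_gradient_add_le (by omega) hf hfi hu hud.differentiable_infty x hw hr
    rw [← ha, ← hα] at hG
    have e : r ^ 2 * ‖∇ u (x + r • (w : RSpace n))‖ ^ 2 = ‖a‖ ^ 2 := by
      rw [ha, norm_smul, mul_pow, Real.norm_of_nonneg hr.le]
    -- Here `a + α w` is the deviation of `r ∇u` from its limit `-α w`. The linear term vanishes by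
    -- the first-power kernel estimate; the square is brought under the integral by Cauchy–Schwarz.
    have h1 : ‖‖a‖ ^ 2 - α ^ 2‖ ≤ ‖a + α • (w : RSpace n)‖ ^ 2
        + 2 * ‖α‖ * ‖a + α • (w : RSpace n)‖ := by
      have h2 : ‖α • (w : RSpace n)‖ = |α| := by rw [norm_smul, hw, mul_one, Real.norm_eq_abs]
      have h3 := norm_sub_le (a + α • (w : RSpace n)) (α • (w : RSpace n))
      have h4 := norm_sub_le (a + α • (w : RSpace n)) a
      rw [add_sub_cancel_right, h2] at h3
      rw [add_sub_cancel_left, h2] at h4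
      rw [Real.norm_eq_abs, Real.norm_eq_abs, abs_le, ← sq_abs α]
      have := abs_nonneg α
      have := norm_nonneg a
      have := norm_nonneg (a + α • (w : RSpace n))
      constructor <;> nlinarith
    have h5 : ‖‖a‖ ^ 2 - α ^ 2‖ₑ ≤ ‖a + α • (w : RSpace n)‖ₑ ^ 2
        + 2 * ‖α‖ₑ * ‖a + α • (w : RSpace n)‖ₑ := by
      have := ENNReal.ofReal_le_ofReal h1
      rw [ENNReal.ofReal_add (by positivity) (by positivity), ENNReal.ofReal_pow (by positivity),
        ENNReal.ofReal_mul (by positivity), ENNReal.ofReal_mul (by positivity), ofReal_norm,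
        ofReal_norm, ofReal_norm] at this
      simpa using this
    rw [e]
    refine h5.trans (add_le_add ?_ ?_)
    · calc _ ≤ (‖c‖ₑ * ∫⁻ y, ‖f y‖ₑ * ENNReal.ofReal (‖r⁻¹ • (y - x)‖ *
            ‖(w : RSpace n) - r⁻¹ • (y - x)‖⁻¹)) ^ 2 := by gcongr
        _ ≤ ‖c‖ₑ ^ 2 * ((∫⁻ y, ‖f y‖ₑ) * ∫⁻ y, ‖f y‖ₑ * ENNReal.ofReal (‖r⁻¹ • (y - x)‖ *
            ‖(w : RSpace n) - r⁻¹ • (y - x)‖⁻¹) ^ 2) := by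
          rw [mul_pow]
          gcongr
          exact lintegral_mul_sq_le hf.measurable.enorm (by fun_prop)
        _ = _ := by
          rw [mul_assoc]
          congr 3
          funext y
          rw [ENNReal.ofReal_pow (by positivity)]
    · rw [mul_assoc (2 * ‖α‖ₑ)]
      gcongr
  · refine Measurable.const_mul ?_ _
    refine Measurable.lintegral_prod_right' (f := fun p : sphere (0 : RSpace n) 1 × RSpace n =>
      ‖f p.2‖ₑ * ENNReal.ofReal ((‖r⁻¹ • (p.2 - x)‖ *
        ‖(p.1 : RSpace n) - r⁻¹ • (p.2 - x)‖⁻¹) ^ 2)) ?_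
    exact (hf.measurable.comp measurable_snd).enorm.mul (by fun_prop)

end Asymptotics

/-! ### The conformal mass equals `α (2 - α)` -/

section Mass

variable {n : ℕ} {u f : RSpace n → ℝ} {c C : ℝ}

theorem sphereArea_pred (hn : 0 < n) : sphereArea (n - 1) = (sphereMeasure n).real Set.univ := by
  obtain ⟨m, rfl⟩ : ∃ m, n = m + 1 := ⟨n - 1, by omega⟩
  rfl

theorem sphereMeasure_real_univ_pos (hn : 0 < n) : 0 < (sphereMeasure n).real Set.univ := by
  have := RSpace.nontrivial hn
  rw [Measure.toSphere_real_apply_univ]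
  simp only [finrank_euclideanSpace, Fintype.card_fin]
  have : 0 < volume.real (ball (0 : RSpace n) 1) :=
    ENNReal.toReal_pos (measure_ball_pos _ _ one_pos).ne' measure_ball_lt_top.ne
  positivity

theorem tendsto_sphereIntegral_scalarCurvature (hn : 4 ≤ n) (hf : Continuous f)
    (hfi : Integrable f) (hu : ∀ x, u x = c * (∫ y, Real.log (‖y‖ / ‖x - y‖) * f y) + C)
    (hud : ContDiff ℝ ∞ u) (x : RSpace n) :
    Tendsto (fun r : ℝ => r ^ (3 - (n : ℤ)) * sphereIntegral
      (fun y => scalarCurvature (conformalMetric u) y * Real.exp (2 * u y)) x r) atTop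
      (𝓝 (((n : ℝ) - 1) * (n - 2) * (sphereMeasure n).real Set.univ *
        ((c * ∫ y, f y) * (2 - c * ∫ y, f y)))) := by
  have h := ((tendsto_sphere_laplacian hn hf hfi hu hud x).const_mul (-(2 * ((n : ℝ) - 1)))).sub
    ((tendsto_sphere_gradient_sq hn hf hfi hu hud x).const_mul (((n : ℝ) - 1) * (n - 2)))
  have e : -(2 * ((n : ℝ) - 1)) * ((sphereMeasure n).real Set.univ *
      (-(c * (n - 2)) * ∫ y, f y)) - ((n : ℝ) - 1) * (n - 2) *
      ((sphereMeasure n).real Set.univ * (c * ∫ y, f y) ^ 2)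
      = ((n : ℝ) - 1) * (n - 2) * (sphereMeasure n).real Set.univ *
        ((c * ∫ y, f y) * (2 - c * ∫ y, f y)) := by ring
  rw [e] at h
  refine h.congr' ?_
  filter_upwards [eventually_gt_atTop 0] with r hr
  have hcont1 : Continuous (fun x => ∑ i, partialDeriv i (partialDeriv i u) x) :=
    continuous_finsetSum _ fun i _ => ((hud.partialDeriv i).partialDeriv i).continuous
  have hcont2 : Continuous (fun x => ∑ i, partialDeriv i u x ^ 2) :=
    continuous_finsetSum _ fun i _ => (hud.partialDeriv i).continuous.pow 2
  have i1 : Integrable (fun w : sphere (0 : RSpace n) 1 => -(2 * ((n : ℝ) - 1)) *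
      (r ^ 2 * ∑ i, partialDeriv i (partialDeriv i u) (x + r • (w : RSpace n))))
      (sphereMeasure n) :=
    (continuous_const.mul (continuous_const.mul
      (hcont1.comp (by fun_prop)))).integrable_of_hasCompactSupport
      (HasCompactSupport.of_compactSpace _)
  have i2 : Integrable (fun w : sphere (0 : RSpace n) 1 => ((n : ℝ) - 1) * (n - 2) *
      (r ^ 2 * ∑ i, partialDeriv i u (x + r • (w : RSpace n)) ^ 2)) (sphereMeasure n) :=
    (continuous_const.mul (continuous_const.mul
      (hcont2.comp (by fun_prop)))).integrable_of_hasCompactSupport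
      (HasCompactSupport.of_compactSpace _)
  rw [← integral_const_mul, ← integral_const_mul, ← integral_sub i1 i2, sphereIntegral,
    ← mul_assoc]
  -- The factor `r ^ (n - 1)` is the Jacobian inside `sphereIntegral`; the remaining `r ^ 2` is the
  -- scaling of `Δu` and `|∇u|²`.
  have e2 : r ^ (3 - (n : ℤ)) * r ^ (n - 1) = r ^ 2 := by
    rw [← zpow_natCast r (n - 1), ← zpow_add₀ hr.ne', ← zpow_natCast r 2]
    congr 1
    push_cast [show 1 ≤ n by omega]
    ring
  rw [e2, ← integral_const_mul]
  congr 1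
  funext w
  rw [scalarCurvature_conformalMetric hud]
  ring

/-- The limit exists and does not depend on the centre, so the `liminf` is a limit and the infimum
is over a constant. -/
theorem conformalMass_eq (hn : 4 ≤ n) (hf : Continuous f)
    (hfi : Integrable f) (hu : ∀ x, u x = c * (∫ y, Real.log (‖y‖ / ‖x - y‖) * f y) + C)
    (hud : ContDiff ℝ ∞ u) :
    conformalMass u = (((c * ∫ y, f y) * (2 - c * ∫ y, f y) : ℝ) : EReal) := by
  have h : ∀ x : RSpace n, liminf (fun r : ℝ =>
      ((r ^ (3 - (n : ℤ)) * sphereIntegral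
        (fun y => scalarCurvature (conformalMetric u) y * Real.exp (2 * u y)) x r : ℝ) : EReal))
        atTop = ((((n : ℝ) - 1) * (n - 2) * (sphereMeasure n).real Set.univ *
        ((c * ∫ y, f y) * (2 - c * ∫ y, f y)) : ℝ) : EReal) := fun x =>
    ((continuous_coe_real_ereal.tendsto _).comp
      (tendsto_sphereIntegral_scalarCurvature hn hf hfi hu hud x)).liminf_eq
  have hS := sphereMeasure_real_univ_pos (n := n) (by omega)
  have hn' : (4 : ℝ) ≤ n := by exact_mod_cast hn
  rw [conformalMass]
  simp only [h, ciInf_const]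
  rw [← EReal.coe_mul, sphereArea_pred (by omega)]
  congr 1
  have h1 : (n : ℝ) - 1 ≠ 0 := by linarith
  have h2 : (n : ℝ) - 2 ≠ 0 := by linarith
  field_simp

end Mass

/-! ### Divergence theorem on balls and selection of radii -/

section RadialDivergence

variable {n : ℕ} {f : RSpace n → ℝ}

theorem integral_eq_integral_sphere_prod (hn : 0 < n) (g : RSpace n → ℝ) :
    ∫ x, g x = ∫ p, g ((p.2 : ℝ) • (p.1 : RSpace n))
      ∂((sphereMeasure n).prod (Measure.volumeIoiPow (n - 1))) := by
  have := RSpace.nontrivial hn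
  have h := (volume : Measure (RSpace n)).measurePreserving_homeomorphUnitSphereProd
    |>.integral_comp (Homeomorph.measurableEmbedding _)
      (fun p => g ((p.2 : ℝ) • (p.1 : RSpace n)))
  simp only [finrank_euclideanSpace, Fintype.card_fin] at h
  rw [← h]
  have e : ∀ x : ({0}ᶜ : Set (RSpace n)),
      (((homeomorphUnitSphereProd (RSpace n) x).2 : ℝ) •
        ((homeomorphUnitSphereProd (RSpace n) x).1 : RSpace n)) = x := by
    intro x
    rw [← homeomorphUnitSphereProd_symm_apply_coe, Homeomorph.symm_apply_apply]
  simp only [e]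
  rw [integral_subtype_comap (measurableSet_singleton _).compl, restrict_compl_singleton]

theorem integral_volumeIoiPow (m : ℕ) (g : ℝ → ℝ) :
    ∫ r : Set.Ioi (0 : ℝ), g r ∂Measure.volumeIoiPow m
      = ∫ r in Set.Ioi (0 : ℝ), r ^ m * g r := by
  simp only [Measure.volumeIoiPow, ENNReal.ofReal]
  rw [integral_withDensity_eq_integral_smul (measurable_subtype_coe.pow_const _).real_toNNReal,
    integral_subtype_comap measurableSet_Ioi fun a : ℝ => Real.toNNReal (a ^ m) • g a]
  refine setIntegral_congr_fun measurableSet_Ioi fun r hr => ?_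
  rw [NNReal.smul_def, Real.coe_toNNReal _ (pow_nonneg hr.out.le _), smul_eq_mul]

theorem integrable_sphere_prod (hn : 0 < n) {g : RSpace n → ℝ} (hg : Integrable g) :
    Integrable (fun p : sphere (0 : RSpace n) 1 × Set.Ioi (0 : ℝ) =>
      g ((p.2 : ℝ) • (p.1 : RSpace n)))
      ((sphereMeasure n).prod (Measure.volumeIoiPow (n - 1))) := by
  have := RSpace.nontrivial hn
  have h := (volume : Measure (RSpace n)).measurePreserving_homeomorphUnitSphereProd
    |>.integrable_comp_emb (Homeomorph.measurableEmbedding _)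
      (g := fun p => g ((p.2 : ℝ) • (p.1 : RSpace n)))
  simp only [finrank_euclideanSpace, Fintype.card_fin] at h
  rw [← h]
  have e : ∀ x : ({0}ᶜ : Set (RSpace n)),
      (((homeomorphUnitSphereProd (RSpace n) x).2 : ℝ) •
        ((homeomorphUnitSphereProd (RSpace n) x).1 : RSpace n)) = x := by
    intro x
    rw [← homeomorphUnitSphereProd_symm_apply_coe, Homeomorph.symm_apply_apply]
  simp only [Function.comp_def, e]
  exact (integrableOn_iff_comap_subtypeVal (measurableSet_singleton _).compl).1 hg.integrableOn

theorem setIntegral_ball_polar (hn : 0 < n) {g : RSpace n → ℝ} (hg : Continuous g) {r : ℝ}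
    (hr : 0 < r) :
    ∫ x in ball (0 : RSpace n) r, g x =
      ∫ w, (∫ s in (0 : ℝ)..r, s ^ (n - 1) * g (s • (w : RSpace n))) ∂sphereMeasure n := by
  have hgi : IntegrableOn g (ball 0 r) :=
    (hg.continuousOn.integrableOn_compact (isCompact_closedBall 0 r)).mono_set
      ball_subset_closedBall
  rw [← integral_indicator measurableSet_ball, integral_eq_integral_sphere_prod hn,
    integral_prod _ (integrable_sphere_prod hn (hgi.integrable_indicator measurableSet_ball))]
  congr 1
  funext w
  have := integral_volumeIoiPow (n - 1) (fun s => (ball 0 r).indicator g (s • (w : RSpace n)))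
  rw [this, intervalIntegral.integral_of_le hr.le, integral_Ioc_eq_integral_Ioo]
  have e : ∀ s ∈ Set.Ioi (0 : ℝ), s ^ (n - 1) * (ball 0 r).indicator g (s • (w : RSpace n))
      = (Set.Iio r).indicator (fun s => s ^ (n - 1) * g (s • (w : RSpace n))) s := by
    intro s hs
    have hmem : s • (w : RSpace n) ∈ ball (0 : RSpace n) r ↔ s ∈ Set.Iio r := by
      rw [mem_ball_zero_iff, norm_smul, Real.norm_of_nonneg (le_of_lt hs)]
      simp
    by_cases h : s ∈ Set.Iio r
    · rw [Set.indicator_of_mem h, Set.indicator_of_mem (hmem.2 h)]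
    · rw [Set.indicator_of_notMem h, Set.indicator_of_notMem (hmem.not.2 h), mul_zero]
  rw [setIntegral_congr_fun measurableSet_Ioi e, setIntegral_indicator measurableSet_Iio]
  rfl

/-- The divergence theorem on a ball for the field `f(x) x`. -/
theorem setIntegral_ball_fderiv_add (hn : 0 < n) (hf : ContDiff ℝ ∞ f) {r : ℝ} (hr : 0 < r) :
    ∫ x in ball (0 : RSpace n) r, (fderiv ℝ f x x + n * f x) =
      ∫ w, r ^ n * f (r • (w : RSpace n)) ∂sphereMeasure n := by
  have hc : Continuous fun x => fderiv ℝ f x x + n * f x :=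
    ((hf.continuous_fderiv (by simp)).clm_apply continuous_id).add
      (continuous_const.mul hf.continuous)
  rw [setIntegral_ball_polar hn hc hr]
  congr 1
  funext w
  -- In polar coordinates the divergence of `f(x) x` is an exact radial derivative, so the
  -- fundamental theorem of calculus on each ray suffices; the end at `0` contributes nothing as `0
  -- < n`.
  have hd : ∀ s : ℝ, HasDerivAt (fun s : ℝ => s ^ n * f (s • (w : RSpace n)))
      (s ^ (n - 1) * (fderiv ℝ f (s • (w : RSpace n)) (s • (w : RSpace n))
        + n * f (s • (w : RSpace n)))) s := by
    intro s
    have h1 : HasDerivAt (fun s : ℝ => s • (w : RSpace n)) (w : RSpace n) s := by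
      simpa using (hasDerivAt_id s).smul_const (w : RSpace n)
    have h2 := ((hf.differentiable (by simp)) (s • (w : RSpace n))).hasFDerivAt.comp_hasDerivAt s h1
    have h3 := (hasDerivAt_pow n s).mul h2
    refine h3.congr_deriv ?_
    rw [map_smul, smul_eq_mul]
    have : s ^ n = s ^ (n - 1) * s := by rw [← pow_succ]; congr 1; omega
    rw [this]
    simp only [Function.comp]
    ring
  rw [intervalIntegral.integral_eq_sub_of_hasDerivAt (fun s _ => hd s)]
  · simp [zero_pow (show n ≠ 0 by omega)]
  · exact Continuous.intervalIntegrable ((continuous_pow _).mul (hc.comp (by fun_prop))) _ _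

/-- `r` times the integral of `|f|` over the sphere of radius `r`. -/
noncomputable def sphereFlux (f : RSpace n → ℝ) (r : ℝ) : ENNReal :=
  ENNReal.ofReal (r ^ n) * ∫⁻ w, ‖f (r • (w : RSpace n))‖ₑ ∂sphereMeasure n

theorem measurable_sphereFlux (hf : Continuous f) : Measurable (sphereFlux f) := by
  refine Measurable.mul (by fun_prop) (Measurable.lintegral_prod_right'
    (f := fun p : ℝ × sphere (0 : RSpace n) 1 => ‖f (p.1 • (p.2 : RSpace n))‖ₑ) ?_)
  exact (hf.measurable.comp (by fun_prop)).enorm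

theorem lintegral_sphereFlux (hn : 0 < n) (hf : Continuous f) :
    ∫⁻ r in Set.Ioi (0 : ℝ), ENNReal.ofReal r⁻¹ * sphereFlux f r = ∫⁻ x, ‖f x‖ₑ := by
  rw [lintegral_polar hn hf.measurable.enorm, lintegral_lintegral_swap]
  · refine setLIntegral_congr_fun measurableSet_Ioi fun r hr => ?_
    rw [lintegral_const_mul' _ _ (by simp), sphereFlux, ← mul_assoc,
      ← ENNReal.ofReal_mul (by have := hr.out; positivity)]
    congr 2
    have : r ^ n = r * r ^ (n - 1) := by rw [← pow_succ']; congr 1; omega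
    rw [this, ← mul_assoc, inv_mul_cancel₀ hr.out.ne', one_mul]
  · have h1 : Measurable fun p : sphere (0 : RSpace n) 1 × ℝ =>
        ENNReal.ofReal (p.2 ^ (n - 1)) := by fun_prop
    have h2 : Measurable fun p : sphere (0 : RSpace n) 1 × ℝ => p.2 • (p.1 : RSpace n) := by
      fun_prop
    exact (h1.mul (hf.measurable.comp h2).enorm).aemeasurable

/-- Otherwise `H ≥ ε` on a half-line, where `dr/r` has infinite mass. -/
theorem exists_lt_of_lintegral_inv_mul_lt_top {H : ℝ → ENNReal}
    (hH : ∫⁻ r in Set.Ioi (0 : ℝ), ENNReal.ofReal r⁻¹ * H r ≠ ⊤) {ε : ENNReal} (hε : ε ≠ 0)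
    (R : ℝ) : ∃ r, R < r ∧ H r < ε := by
  by_contra! hcon
  have hfin : ∫⁻ r in Set.Ioi (max R 1), ENNReal.ofReal r⁻¹ ≠ ⊤ := by
    intro htop
    apply hH
    rw [eq_top_iff]
    calc ⊤ = (∫⁻ r in Set.Ioi (max R 1), ENNReal.ofReal r⁻¹) * ε := by
          rw [htop, ENNReal.top_mul hε]
      _ = ∫⁻ r in Set.Ioi (max R 1), ENNReal.ofReal r⁻¹ * ε := by
          rw [lintegral_mul_const _ (by fun_prop)]
      _ ≤ ∫⁻ r in Set.Ioi (max R 1), ENNReal.ofReal r⁻¹ * H r := by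
          refine setLIntegral_mono' measurableSet_Ioi fun r hr => ?_
          gcongr
          exact hcon r ((le_max_left _ _).trans_lt hr)
      _ ≤ _ := lintegral_mono_set (Set.Ioi_subset_Ioi (le_trans zero_le_one (le_max_right _ _)))
  refine not_integrableOn_Ioi_inv (a := max R 1) ⟨by fun_prop, ?_⟩
  rw [hasFiniteIntegral_iff_norm]
  refine lt_of_eq_of_lt (setLIntegral_congr_fun measurableSet_Ioi fun r hr => ?_) hfin.lt_top
  have : 0 < r := (lt_of_lt_of_le one_pos (le_max_right _ _)).trans hr
  rw [Real.norm_of_nonneg (by positivity)]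

end RadialDivergence

/-! ### Symmetrisation of the pair integral and the cross term -/

section Interaction

variable {n : ℕ} {f : RSpace n → ℝ}

/-- The density `f(x) f(y) x · (x - y) / |x - y|²`. -/
noncomputable def pairDensity (f : RSpace n → ℝ) (p : RSpace n × RSpace n) : ℝ :=
  f p.1 * (inner ℝ (invKernel (p.1 - p.2)) p.1 * f p.2)

/-- The interaction of `B_r(0)` with its complement, in absolute value. -/
noncomputable def crossInteraction (f : RSpace n → ℝ) (r : ℝ) : ENNReal :=
  ∫⁻ p, ‖f p.1‖ₑ * ‖f p.2‖ₑ * ENNReal.ofReal (‖p.1‖ * ‖p.1 - p.2‖⁻¹)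
    ∂((volume.restrict (ball (0 : RSpace n) r)).prod (volume.restrict (ball (0 : RSpace n) r)ᶜ))

theorem measurable_pairDensity (hf : Continuous f) : Measurable (pairDensity f) := by
  have h1 : Measurable fun p : RSpace n × RSpace n => invKernel (p.1 - p.2) :=
    measurable_invKernel.comp (by fun_prop)
  exact (hf.measurable.comp measurable_fst).mul ((h1.inner measurable_fst).mul
    (hf.measurable.comp measurable_snd))

theorem enorm_pairDensity_le (p : RSpace n × RSpace n) :
    ‖pairDensity f p‖ₑ ≤ ‖f p.1‖ₑ * ‖f p.2‖ₑ * ENNReal.ofReal (‖p.1‖ * ‖p.1 - p.2‖⁻¹) := by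
  rw [pairDensity, enorm_mul, enorm_mul, mul_comm ‖inner ℝ _ _‖ₑ, ← mul_assoc]
  gcongr
  rw [← ofReal_norm]
  refine ENNReal.ofReal_le_ofReal ?_
  have := abs_real_inner_le_norm (invKernel (p.1 - p.2)) p.1
  rwa [norm_invKernel, mul_comm] at this

theorem integrable_pairDensity (hn : 1 < n) (hf : Continuous f) (hfi : Integrable f) (r : ℝ) :
    Integrable (pairDensity f) ((volume.restrict (ball (0 : RSpace n) r)).prod volume) := by
  refine ⟨(measurable_pairDensity hf).aestronglyMeasurable, ?_⟩
  -- Radius `r + 1` so that the bound holds on the unit ball around every point of `ball 0 r`.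
  obtain ⟨M, hM0, hM⟩ := exists_bound_on_ball hf 0 (r + 1)
  set W := ∫ z in ball (0 : RSpace n) 1, ‖z‖⁻¹ ^ 1 with hW
  have hin : ∀ x ∈ ball (0 : RSpace n) r, ∫⁻ y, ‖f y‖ₑ * ENNReal.ofReal ‖x - y‖⁻¹ ≤
      ENNReal.ofReal M * ENNReal.ofReal W + ∫⁻ y, ‖f y‖ₑ := by
    intro x hx
    have hWx : ENNReal.ofReal W = ∫⁻ y in ball x 1, ENNReal.ofReal ‖x - y‖⁻¹ := by
      rw [hW, ← setIntegral_ball_inv_norm_sub_pow x,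
        ofReal_integral_eq_lintegral_ofReal (integrableOn_ball_inv_norm_sub_pow hn x 1)
          (Eventually.of_forall fun x => by positivity)]
      simp only [pow_one]
    rw [hWx, ← lintegral_add_compl _ (measurableSet_ball (x := x) (ε := 1)),
      ← lintegral_const_mul' _ _ ENNReal.ofReal_ne_top]
    refine add_le_add ?_ ?_
    · refine setLIntegral_mono' measurableSet_ball fun y hy => ?_
      gcongr
      rw [← ofReal_norm]
      refine ENNReal.ofReal_le_ofReal (hM y ?_)
      rw [mem_ball] at hx hy ⊢
      linarith [dist_triangle y x 0]
    · refine (setLIntegral_mono' (g := fun y => ‖f y‖ₑ) measurableSet_ball.compl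
        fun y hy => ?_).trans (setLIntegral_le_lintegral _ _)
      refine mul_le_of_le_one_right zero_le ?_
      rw [← ENNReal.ofReal_one]
      refine ENNReal.ofReal_le_ofReal (inv_le_one_of_one_le₀ ?_)
      simpa [dist_eq_norm, norm_sub_rev] using hy
  set D := ENNReal.ofReal M * ENNReal.ofReal W + ∫⁻ y, ‖f y‖ₑ with hD
  have hDfin : D ≠ ⊤ := by
    have := hfi.2.ne
    rw [hD]
    finiteness
  rw [HasFiniteIntegral, lintegral_prod _ (measurable_pairDensity hf).enorm.aemeasurable]
  calc _ ≤ ∫⁻ x in ball (0 : RSpace n) r, ‖f x‖ₑ * (ENNReal.ofReal r * D) := by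
        refine setLIntegral_mono' measurableSet_ball fun x hx => ?_
        calc _ ≤ ∫⁻ y, ‖f x‖ₑ * (ENNReal.ofReal r * (‖f y‖ₑ * ENNReal.ofReal ‖x - y‖⁻¹)) := by
              refine lintegral_mono fun y => (enorm_pairDensity_le (x, y)).trans ?_
              dsimp only
              rw [ENNReal.ofReal_mul (norm_nonneg _), mul_assoc]
              gcongr ‖f x‖ₑ * ?_
              rw [mul_left_comm]
              gcongr
              exact (mem_ball_zero_iff.1 hx).le
          _ = ‖f x‖ₑ * (ENNReal.ofReal r * ∫⁻ y, ‖f y‖ₑ * ENNReal.ofReal ‖x - y‖⁻¹) := by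
              rw [lintegral_const_mul' _ _ enorm_ne_top,
                lintegral_const_mul' _ _ ENNReal.ofReal_ne_top]
          _ ≤ _ := by gcongr; exact hin x hx
    _ ≤ (∫⁻ x, ‖f x‖ₑ) * (ENNReal.ofReal r * D) := by
        rw [lintegral_mul_const _ hf.measurable.enorm]
        gcongr
        exact Measure.restrict_le_self
    _ < ⊤ := ENNReal.mul_lt_top hfi.2 (ENNReal.mul_lt_top (by simp) hDfin.lt_top)

/-- The kernel is odd, and `(x - y)·x - (x - y)·y = |x - y|²` cancels its denominator. -/
theorem pairDensity_add_swap (f : RSpace n → ℝ) {x y : RSpace n} (h : y ≠ x) :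
    pairDensity f (x, y) + pairDensity f (y, x) = f x * f y := by
  have h0 : x - y ≠ 0 := sub_ne_zero.2 h.symm
  have h1 : inner ℝ (invKernel (x - y)) x + inner ℝ (invKernel (y - x)) y = 1 := by
    have : invKernel (y - x) = -invKernel (x - y) := by
      rw [invKernel, invKernel, ← neg_sub x y, norm_neg, smul_neg]
    rw [this, inner_neg_left, ← sub_eq_add_neg, ← inner_sub_right, invKernel,
      real_inner_smul_left, real_inner_self_eq_norm_sq]
    have := norm_ne_zero_iff.2 h0
    field_simp
  simp only [pairDensity]
  linear_combination (f x * f y) * h1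

theorem integral_pairDensity_ball (hn : 1 < n) (hf : Continuous f) (hfi : Integrable f) (r : ℝ) :
    2 * ∫ p, pairDensity f p ∂((volume.restrict (ball (0 : RSpace n) r)).prod
      (volume.restrict (ball (0 : RSpace n) r))) = (∫ x in ball (0 : RSpace n) r, f x) ^ 2 := by
  have := RSpace.nontrivial (n := n) (by omega)
  set ν := volume.restrict (ball (0 : RSpace n) r) with hν
  have hi : Integrable (pairDensity f) (ν.prod ν) := by
    have := (integrable_pairDensity hn hf hfi r).integrableOn
      (s := Set.univ ×ˢ ball (0 : RSpace n) r)
    rwa [IntegrableOn, ← Measure.prod_restrict, Measure.restrict_univ] at this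
  have hs := integral_prod_swap (μ := ν) (ν := ν) (pairDensity f)
  have hi' : Integrable (fun p : RSpace n × RSpace n => pairDensity f p.swap) (ν.prod ν) := hi.swap
  have hadd := integral_add hi hi'
  rw [hs] at hadd
  rw [two_mul, ← hadd, integral_prod _ (hi.fun_add hi'), sq, ← integral_mul_const]
  congr 1
  funext x
  rw [← integral_const_mul]
  refine integral_congr_ae ?_
  filter_upwards [ae_restrict_of_ae (Measure.ae_ne volume x)] with y hy
  exact pairDensity_add_swap f hy

/-- `∫_{B_r} ∫ f(x) f(y) x · (x - y) / |x - y|² dy dx` differs from `½ (∫_{B_r} f)²` by at most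
the interaction of `B_r` with its complement. -/
theorem enorm_integral_pairDensity_sub_le (hn : 1 < n) (hf : Continuous f) (hfi : Integrable f)
    (r : ℝ) :
    ‖(∫ x in ball (0 : RSpace n) r, f x * ∫ y, inner ℝ (invKernel (x - y)) x * f y)
      - (∫ x in ball (0 : RSpace n) r, f x) ^ 2 / 2‖ₑ ≤ crossInteraction f r := by
  have hi := integrable_pairDensity hn hf hfi r
  have e1 : (∫ x in ball (0 : RSpace n) r, f x * ∫ y, inner ℝ (invKernel (x - y)) x * f y)
      = ∫ p, pairDensity f p ∂((volume.restrict (ball (0 : RSpace n) r)).prod volume) := by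
    rw [integral_prod _ hi]
    simp only [pairDensity, integral_const_mul]
  have hr : ∀ s : Set (RSpace n), ((volume.restrict (ball (0 : RSpace n) r)).prod volume).restrict
      (Set.univ ×ˢ s) = (volume.restrict (ball (0 : RSpace n) r)).prod (volume.restrict s) := by
    intro s
    rw [← Measure.prod_restrict, Measure.restrict_univ]
  have hm : MeasurableSet ((Set.univ : Set (RSpace n)) ×ˢ ball (0 : RSpace n) r) :=
    MeasurableSet.univ.prod measurableSet_ball
  have e2 := integral_add_compl hm hi
  have hc : ((Set.univ : Set (RSpace n)) ×ˢ ball (0 : RSpace n) r)ᶜ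
      = Set.univ ×ˢ (ball (0 : RSpace n) r)ᶜ := by
    ext p; simp
  rw [hc, hr, hr] at e2
  rw [e1, ← e2, ← integral_pairDensity_ball hn hf hfi r, mul_div_cancel_left₀ _ two_ne_zero,
    add_sub_cancel_left]
  exact (enorm_integral_le_lintegral_enorm _).trans (lintegral_mono enorm_pairDensity_le)

theorem crossInteraction_eq (f : RSpace n → ℝ) (r : ℝ) :
    crossInteraction f r = ∫⁻ p : RSpace n × RSpace n,
      ‖f p.1‖ₑ * ‖f p.2‖ₑ * ENNReal.ofReal (‖p.1‖ * ‖p.1 - p.2‖⁻¹) *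
        (Set.Ioc ‖p.1‖ ‖p.2‖).indicator 1 r := by
  rw [crossInteraction, Measure.prod_restrict,
    ← lintegral_indicator (measurableSet_ball.prod measurableSet_ball.compl)]
  congr 1
  funext p
  by_cases h : p ∈ ball (0 : RSpace n) r ×ˢ (ball (0 : RSpace n) r)ᶜ
  · have h' : r ∈ Set.Ioc ‖p.1‖ ‖p.2‖ := by simpa using h
    simp [h, h']
  · have h' : r ∉ Set.Ioc ‖p.1‖ ‖p.2‖ := by simpa using h
    simp [h, h']

/-- The spheres separating `a` from `b` have radii in `(‖a‖, ‖b‖]`. There `1/r ≤ 1/‖a‖`, so the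
product is at most `(‖b‖ - ‖a‖) / ‖a - b‖ ≤ 1`: the `dr/r` average absorbs the singularity. -/
theorem lintegral_inv_mul_indicator_le (a b : RSpace n) :
    ENNReal.ofReal (‖a‖ * ‖a - b‖⁻¹) * ∫⁻ r in Set.Ioi (0 : ℝ), ENNReal.ofReal r⁻¹ *
      (Set.Ioc ‖a‖ ‖b‖).indicator 1 r ≤ 1 := by
  rcases eq_or_ne a 0 with rfl | ha
  · simp
  have ha' : 0 < ‖a‖ := norm_pos_iff.2 ha
  calc _ ≤ ENNReal.ofReal (‖a‖ * ‖a - b‖⁻¹) * ∫⁻ r in Set.Ioc ‖a‖ ‖b‖,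
        ENNReal.ofReal ‖a‖⁻¹ := by
        refine mul_le_mul' le_rfl ((setLIntegral_le_lintegral _ _).trans ?_)
        rw [← lintegral_indicator measurableSet_Ioc]
        refine lintegral_mono fun r => ?_
        by_cases h : r ∈ Set.Ioc ‖a‖ ‖b‖
        · simp only [Set.indicator_of_mem h, Pi.one_apply, mul_one]
          exact ENNReal.ofReal_le_ofReal (inv_anti₀ ha' h.1.le)
        · simp [h]
    _ = ENNReal.ofReal (‖a‖ * ‖a - b‖⁻¹ * (‖a‖⁻¹ * (‖b‖ - ‖a‖))) := by
        rw [setLIntegral_const, Real.volume_Ioc, ← ENNReal.ofReal_mul (by positivity),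
          ← ENNReal.ofReal_mul (by positivity)]
    _ ≤ ENNReal.ofReal 1 := by
        refine ENNReal.ofReal_le_ofReal ?_
        calc _ = ‖a - b‖⁻¹ * (‖b‖ - ‖a‖) := by field_simp
          _ ≤ ‖a - b‖⁻¹ * ‖a - b‖ := by
              gcongr
              rw [norm_sub_rev]
              exact norm_sub_norm_le b a
          _ ≤ 1 := inv_mul_le_one
    _ = 1 := ENNReal.ofReal_one

theorem lintegral_crossInteraction_le (hf : Continuous f) :
    ∫⁻ r in Set.Ioi (0 : ℝ), ENNReal.ofReal r⁻¹ * crossInteraction f r ≤ (∫⁻ x, ‖f x‖ₑ) ^ 2 := by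
  simp only [crossInteraction_eq f]
  have hm1 : Measurable fun p : RSpace n × RSpace n =>
      ‖f p.1‖ₑ * ‖f p.2‖ₑ * ENNReal.ofReal (‖p.1‖ * ‖p.1 - p.2‖⁻¹) :=
    ((hf.measurable.comp measurable_fst).enorm.mul (hf.measurable.comp measurable_snd).enorm).mul
      (by fun_prop)
  have hs : MeasurableSet {q : ℝ × (RSpace n × RSpace n) | ‖q.2.1‖ < q.1 ∧ q.1 ≤ ‖q.2.2‖} :=
    (measurableSet_lt measurable_snd.fst.norm measurable_fst).inter
      (measurableSet_le measurable_fst measurable_snd.snd.norm)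
  have hm2 : Measurable fun q : ℝ × (RSpace n × RSpace n) =>
      (Set.Ioc ‖q.2.1‖ ‖q.2.2‖).indicator (1 : ℝ → ENNReal) q.1 :=
    (measurable_const (a := (1 : ENNReal))).indicator hs
  have hm3 : Measurable fun q : ℝ × (RSpace n × RSpace n) => ENNReal.ofReal q.1⁻¹ *
      (‖f q.2.1‖ₑ * ‖f q.2.2‖ₑ * ENNReal.ofReal (‖q.2.1‖ * ‖q.2.1 - q.2.2‖⁻¹) *
        (Set.Ioc ‖q.2.1‖ ‖q.2.2‖).indicator 1 q.1) :=
    (by fun_prop : Measurable fun q : ℝ × (RSpace n × RSpace n) => ENNReal.ofReal q.1⁻¹).mul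
      ((hm1.comp measurable_snd).mul hm2)
  calc _ = ∫⁻ r in Set.Ioi (0 : ℝ), ∫⁻ p : RSpace n × RSpace n, ENNReal.ofReal r⁻¹ *
        (‖f p.1‖ₑ * ‖f p.2‖ₑ * ENNReal.ofReal (‖p.1‖ * ‖p.1 - p.2‖⁻¹) *
          (Set.Ioc ‖p.1‖ ‖p.2‖).indicator 1 r) := by
        congr 1
        funext r
        rw [lintegral_const_mul' _ _ ENNReal.ofReal_ne_top]
    _ = ∫⁻ p : RSpace n × RSpace n, ∫⁻ r in Set.Ioi (0 : ℝ), ENNReal.ofReal r⁻¹ *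
        (‖f p.1‖ₑ * ‖f p.2‖ₑ * ENNReal.ofReal (‖p.1‖ * ‖p.1 - p.2‖⁻¹) *
          (Set.Ioc ‖p.1‖ ‖p.2‖).indicator 1 r) := lintegral_lintegral_swap hm3.aemeasurable
    _ ≤ ∫⁻ p : RSpace n × RSpace n, ‖f p.1‖ₑ * ‖f p.2‖ₑ := by
        refine lintegral_mono fun p => ?_
        have hfin : ‖f p.1‖ₑ * ‖f p.2‖ₑ ≠ ⊤ := by finiteness
        have hfin' : ‖f p.1‖ₑ * ‖f p.2‖ₑ * ENNReal.ofReal (‖p.1‖ * ‖p.1 - p.2‖⁻¹) ≠ ⊤ := by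
          finiteness
        simp only [mul_left_comm (ENNReal.ofReal _⁻¹) (_ * _) _]
        rw [lintegral_const_mul' _ _ hfin', mul_assoc]
        exact mul_le_of_le_one_right zero_le (lintegral_inv_mul_indicator_le p.1 p.2)
    _ = _ := by
        rw [Measure.volume_eq_prod, lintegral_prod_mul hf.measurable.enorm.aemeasurable
          hf.measurable.enorm.aemeasurable, sq]

end Interaction

/-! ### The Pohozaev identity on balls and its limit -/

section Pohozaev

variable {n : ℕ} {u f : RSpace n → ℝ} {c C : ℝ}

theorem ContDiff.laplacian_infty (hf : ContDiff ℝ ∞ f) :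
    ContDiff ℝ ∞ (Laplacian.laplacian f) := by
  rw [InnerProductSpace.laplacian_eq_iteratedFDeriv_orthonormalBasis f
    (stdOrthonormalBasis ℝ (RSpace n))]
  refine ContDiff.sum fun i _ => ?_
  simp only [iteratedFDeriv_two_apply]
  exact (((hf.fderiv_right (m := ∞) (by simp)).fderiv_right (m := ∞) (by simp)).clm_apply
    contDiff_const).clm_apply contDiff_const

theorem contDiff_iterate_neg_laplacian (hu : ContDiff ℝ ∞ u) (k : ℕ) :
    ContDiff ℝ ∞ ((fun f : RSpace n → ℝ => -Laplacian.laplacian f)^[k] u) := by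
  induction k with
  | zero => exact hu
  | succ k ih =>
    rw [Function.iterate_succ_apply']
    exact ih.laplacian_infty.neg

theorem qCurvature_mul_exp (u : RSpace n → ℝ) (x : RSpace n) :
    qCurvature u x * Real.exp (n * u x)
      = ((fun f : RSpace n → ℝ => -Laplacian.laplacian f)^[n / 2] u) x := by
  rw [qCurvature, mul_assoc, ← Real.exp_add]
  simp

/-- Differentiating `Q = f e^{-nu}` and multiplying by `e^{nu}` cancels the exponentials, so only
`f` and `∇u` remain. -/
theorem pohozaevDensity_eq (hu : ContDiff ℝ ∞ u) (hf : ContDiff ℝ ∞ f)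
    (hQ : ∀ x, qCurvature u x = f x * Real.exp (-(n * u x))) (x : RSpace n) :
    pohozaevDensity u x = fderiv ℝ f x x - n * (f x * fderiv ℝ u x x) := by
  have h : HasFDerivAt (fun x => f x * Real.exp (-(n * u x))) _ x :=
    (hf.differentiable_infty x).hasFDerivAt.mul
      (((hu.differentiable_infty x).hasFDerivAt.const_mul (n : ℝ)).neg.exp)
  rw [pohozaevDensity, show qCurvature u = fun x => f x * Real.exp (-(n * u x)) from funext hQ,
    real_inner_comm, inner_gradient_eq_fderiv, h.fderiv]
  have e : Real.exp (-(n * u x)) * Real.exp (n * u x) = 1 := by rw [← Real.exp_add]; simp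
  simp only [add_apply, smul_apply, neg_apply, smul_eq_mul]
  linear_combination (fderiv ℝ f x x - n * (f x * fderiv ℝ u x x)) * e

theorem Continuous.integrableOn_ball {g : RSpace n → ℝ} (hg : Continuous g) (r : ℝ) :
    IntegrableOn g (ball 0 r) :=
  (hg.continuousOn.integrableOn_compact (isCompact_closedBall 0 r)).mono_set
    ball_subset_closedBall

theorem setIntegral_pohozaevDensity (hn : 1 < n) (hu : ContDiff ℝ ∞ u) (hf : ContDiff ℝ ∞ f)
    (hfi : Integrable f) (hpot : ∀ x, u x = c * (∫ y, Real.log (‖y‖ / ‖x - y‖) * f y) + C)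
    (hQ : ∀ x, qCurvature u x = f x * Real.exp (-(n * u x))) {r : ℝ} (hr : 0 < r) :
    ∫ x in ball (0 : RSpace n) r, pohozaevDensity u x =
      (∫ w, r ^ n * f (r • (w : RSpace n)) ∂sphereMeasure n)
        - n * (∫ x in ball (0 : RSpace n) r, f x)
        + n * c * ∫ x in ball (0 : RSpace n) r,
          f x * ∫ y, inner ℝ (invKernel (x - y)) x * f y := by
  have h1 : Continuous fun x => fderiv ℝ f x x + n * f x :=
    ((hf.continuous_fderiv (by simp)).clm_apply continuous_id).add
      (continuous_const.mul hf.continuous)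
  have h2 : Continuous fun x => n * f x := continuous_const.mul hf.continuous
  have h3 : Continuous fun x => n * (f x * fderiv ℝ u x x) :=
    continuous_const.mul (hf.continuous.mul
      ((hu.continuous_fderiv (by simp)).clm_apply continuous_id))
  have e : ∀ x, pohozaevDensity u x
      = (fderiv ℝ f x x + n * f x) - n * f x - n * (f x * fderiv ℝ u x x) := by
    intro x; rw [pohozaevDensity_eq hu hf hQ]; ring
  simp only [e]
  rw [integral_sub ((h1.fun_sub h2).integrableOn_ball r) (h3.integrableOn_ball r),
    integral_sub (h1.integrableOn_ball r) (h2.integrableOn_ball r),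
    setIntegral_ball_fderiv_add (by omega) hf hr, integral_const_mul, integral_const_mul]
  simp only [fderiv_logPotential hn hf.continuous hfi hpot hu.differentiable_infty]
  rw [sub_eq_add_neg, ← integral_neg, ← integral_const_mul (n * c)]
  congr 2
  funext x
  ring

theorem tendsto_setIntegral_ball {g : RSpace n → ℝ} (hg : Integrable g) :
    Tendsto (fun r : ℝ => ∫ x in ball (0 : RSpace n) r, g x) atTop (𝓝 (∫ x, g x)) := by
  refine (aecover_ball tendsto_id).integral_tendsto_of_countably_generated hg

theorem exists_seq_tendsto_pohozaev (hn : 1 < n) (hu : ContDiff ℝ ∞ u) (hf : ContDiff ℝ ∞ f)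
    (hfi : Integrable f) (hpot : ∀ x, u x = c * (∫ y, Real.log (‖y‖ / ‖x - y‖) * f y) + C)
    (hQ : ∀ x, qCurvature u x = f x * Real.exp (-(n * u x))) :
    ∃ R : ℕ → ℝ, Tendsto R atTop atTop ∧
      Tendsto (fun k : ℕ => ∫ x in ball (0 : RSpace n) (R k), pohozaevDensity u x) atTop
        (𝓝 (-n * (∫ x, f x) + n * c * ((∫ x, f x) ^ 2 / 2))) := by
  -- The two error terms are added before radii are selected, so that a single sequence makes both
  -- small.
  have hH : ∫⁻ r in Set.Ioi (0 : ℝ), ENNReal.ofReal r⁻¹ *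
      (sphereFlux f r + crossInteraction f r) ≠ ⊤ := by
    simp only [mul_add]
    have hm : Measurable fun r : ℝ => ENNReal.ofReal r⁻¹ * sphereFlux f r :=
      Measurable.mul (by fun_prop) (measurable_sphereFlux hf.continuous)
    rw [lintegral_add_left hm,
      lintegral_sphereFlux (by omega) hf.continuous]
    refine ENNReal.add_ne_top.2 ⟨hfi.2.ne, ?_⟩
    exact ((lintegral_crossInteraction_le hf.continuous).trans_lt
      (ENNReal.pow_lt_top hfi.2)).ne
  have hex : ∀ k : ℕ, ∃ r : ℝ, (k : ℝ) < r ∧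
      sphereFlux f r + crossInteraction f r < ((k : ENNReal) + 1)⁻¹ := fun k =>
    exists_lt_of_lintegral_inv_mul_lt_top hH (by simp) k
  choose R hR hRlt using hex
  have hRtop : Tendsto R atTop atTop :=
    tendsto_atTop_mono (fun k => (hR k).le) tendsto_natCast_atTop_atTop
  refine ⟨R, hRtop, ?_⟩
  have hsum : Tendsto (fun k => sphereFlux f (R k) + crossInteraction f (R k)) atTop (𝓝 0) := by
    refine tendsto_of_tendsto_of_tendsto_of_le_of_le tendsto_const_nhds ?_ (fun _ => zero_le)
      fun k => (hRlt k).le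
    have := (tendsto_add_atTop_iff_nat 1).2 ENNReal.tendsto_inv_nat_nhds_zero
    simpa using this
  have hRpos : ∀ k, 0 < R k := fun k => (Nat.cast_nonneg k).trans_lt (hR k)
  have hflux : Tendsto (fun k => ∫ w, R k ^ n * f (R k • (w : RSpace n)) ∂sphereMeasure n)
      atTop (𝓝 0) := by
    rw [tendsto_zero_iff_enorm_tendsto_zero]
    refine tendsto_of_tendsto_of_tendsto_of_le_of_le tendsto_const_nhds hsum (fun _ => zero_le)
      fun k => ?_
    refine le_add_right ((enorm_integral_le_lintegral_enorm _).trans (le_of_eq ?_))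
    rw [sphereFlux, ← lintegral_const_mul' _ _ ENNReal.ofReal_ne_top]
    congr 1
    funext w
    rw [enorm_mul, Real.enorm_eq_ofReal (pow_nonneg (hRpos k).le n)]
  have hball := (tendsto_setIntegral_ball hfi).comp hRtop
  have hpair : Tendsto (fun k => ∫ x in ball (0 : RSpace n) (R k),
      f x * ∫ y, inner ℝ (invKernel (x - y)) x * f y) atTop (𝓝 ((∫ x, f x) ^ 2 / 2)) := by
    have h0 : Tendsto (fun k => (∫ x in ball (0 : RSpace n) (R k),
        f x * ∫ y, inner ℝ (invKernel (x - y)) x * f y)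
          - (∫ x in ball (0 : RSpace n) (R k), f x) ^ 2 / 2) atTop (𝓝 0) := by
      rw [tendsto_zero_iff_enorm_tendsto_zero]
      refine tendsto_of_tendsto_of_tendsto_of_le_of_le tendsto_const_nhds hsum (fun _ => zero_le)
        fun k => le_add_left ?_
      exact enorm_integral_pairDensity_sub_le hn hf.continuous hfi (R k)
    have := h0.add ((hball.pow 2).div_const 2)
    simpa using this
  have := (hflux.sub (hball.const_mul (n : ℝ))).add (hpair.const_mul (n * c))
  rw [zero_sub, ← neg_mul] at this
  refine this.congr fun k => ?_
  rw [setIntegral_pohozaevDensity hn hu hf hfi hpot hQ (hRpos k)]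
  rfl

end Pohozaev

/-! ### Matching the two computations -/

theorem mainTheorem12 (n : ℕ) (hn : 4 ≤ n) (hne : Even n) (u : RSpace n → ℝ)
    (hu : ContDiff ℝ ∞ u) (hQ : HasFiniteTotalQCurvature u) (hnormal : IsNormalMetric u) :
    -- the identity, when the integral converges absolutely
    (Integrable (pohozaevDensity u) →
      conformalMass u
        = ((-(4 / (n ! * sphereArea n)) * ∫ x : RSpace n, pohozaevDensity u x : ℝ) : EReal)) ∧
    -- the identity, when the integral converges as an improper integral over balls
    (∀ I : ℝ, Tendsto (fun r : ℝ => ∫ x in ball (0 : RSpace n) r, pohozaevDensity u x) atTop (𝓝 I) →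
      conformalMass u = ((-(4 / (n ! * sphereArea n)) * I : ℝ) : EReal)) ∧
    -- in all cases, along a sequence of balls
    (∃ m : ℝ, conformalMass u = (m : EReal) ∧
      ∃ R : ℕ → ℝ, Tendsto R atTop atTop ∧
        Tendsto (fun k : ℕ => -(4 / (n ! * sphereArea n)) *
          ∫ x in ball (0 : RSpace n) (R k), pohozaevDensity u x) atTop (𝓝 m)) := by
  set f : RSpace n → ℝ := (fun f : RSpace n → ℝ => -Laplacian.laplacian f)^[n / 2] u with hf_def
  have hf : ContDiff ℝ ∞ f := contDiff_iterate_neg_laplacian hu _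
  have hfi : Integrable f := by
    have := hQ
    simp only [HasFiniteTotalQCurvature, qCurvature_mul_exp] at this
    exact this
  obtain ⟨-, C, hpot⟩ := hnormal
  simp only [qCurvature_mul_exp, ← hf_def] at hpot
  set c : ℝ := 2 / ((n - 1)! * sphereArea n) with hc
  have hmass := conformalMass_eq hn hf.continuous hfi hpot hu
  obtain ⟨R, hR, hlim⟩ := exists_seq_tendsto_pohozaev (by omega) hu hf hfi hpot (fun _ => rfl)
  -- The only place where the value of `c` matters: this normalisation turns the Pohozaev limit `-n
  -- F + n c F² / 2`, with `F = ∫ f`, into `cF (2 - cF)`.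
  have hconst : 4 / (n ! * sphereArea n) = 2 * c / n := by
    have h1 : ((n ! : ℕ) : ℝ) = n * ((n - 1)! : ℕ) := by
      exact_mod_cast (Nat.mul_factorial_pred (by omega : n ≠ 0)).symm
    rw [h1, hc]
    ring
  have hn0 : (n : ℝ) ≠ 0 := by positivity
  have hlim' := hlim.const_mul (-(4 / (n ! * sphereArea n)))
  have e : -(4 / (n ! * sphereArea n)) * (-n * (∫ x, f x) + n * c * ((∫ x, f x) ^ 2 / 2))
      = (c * ∫ x, f x) * (2 - c * ∫ x, f x) := by
    rw [hconst]
    field_simp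
    ring
  rw [e] at hlim'
  -- A limit over all balls must agree with the limit along `R`; absolute convergence is a special
  -- case.
  have himproper : ∀ I : ℝ, Tendsto (fun r : ℝ => ∫ x in ball (0 : RSpace n) r,
      pohozaevDensity u x) atTop (𝓝 I) →
      conformalMass u = ((-(4 / (n ! * sphereArea n)) * I : ℝ) : EReal) := by
    intro I hI
    rw [hmass, tendsto_nhds_unique hlim' ((hI.comp hR).const_mul _)]
  exact ⟨fun hint => himproper _ (tendsto_setIntegral_ball hint), himproper,
    _, hmass, R, hR, hlim'⟩
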